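/- All graphs are finite and simple. Let $G$ be a nontrivial connected graph (i.e. with at least two vertices). An edge-coloring of $G$ with $k$ colors is any map $c:E(G)\to\{1,\dots,k\}$ (adjacent edges may get the same color). For two distinct vertices $u,v$ of $G$, a $u$-$v$ rainbow cut is a set $R\subseteq E(G)$ such that no two edges of $R$ have the same color and $u$ and $v$ lie in different components of $G-R$. The rainbow disconnection number $rd(G)$ is the least $k$ for which $G$ has an edge-coloring with $k$ colors such that every two distinct vertices $u,v$ admit a $u$-$v$ rainbow cut. Let $\overline{G}$ denote the complement of $G$. If $G$ is a graph of order $n\ge 2$ such that $G$ and $\overline{G}$ are both connected (which forces $n\ge 4$), then $$n-2\le rd(G)+rd(\overline{G})\le 2n-5 \quad\text{and}\quad n-3\le rd(G)\cdot rd(\overline{G})\le (n-2)(n-3).$$ The bounds are sharp: (a) For every $n\ge 6$, both upper bounds are attained simultaneously by the following graph $G$ of order $n$: for distinct vertices $u,v,w,y$, the edges of $G$ are $uv$, all $xu$ and $xv$ with $x\in V(G)\setminus\{u,v,w\}$, and $wy$. Both $G$ and $\overline{G}$ are connected, $rd(G)+rd(\overline{G})=2n-5$ and $rd(G)\cdot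 rd(\overline{G})=(n-2)(n-3)$. (b) The path $P_4$ of order $4$ is isomorphic to its complement, and for $G=P_4$ (so $n=4$) both lower bounds are attained: $rd(G)+rd(\overline{G})=2=n-2$ and $rd(G)\cdot rd(\overline{G})=1=n-3$. -/

import Mathlib

/-- A set `R` of edges of `G` is a `u`-`v` rainbow cut for the edge-coloring `c` if no two edges of
`R` have the same color and `u`, `v` lie in different components of `G - R`. -/
def SimpleGraph.IsRainbowCut {V K : Type*} (G : SimpleGraph V) (c : G.edgeSet → K)
    (R : Set G.edgeSet) (u v : V) : Prop :=
  Set.InjOn c R ∧ ¬ (G.deleteEdges (Subtype.val '' R)).Reachable u v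

/-- An edge-coloring `c` of `G` (not necessarily proper) is a rainbow disconnection coloring if any
two distinct vertices are separated by a rainbow cut. -/
def SimpleGraph.IsRainbowDisconnectionColoring {V K : Type*} (G : SimpleGraph V)
    (c : G.edgeSet → K) : Prop :=
  ∀ u v : V, u ≠ v → ∃ R : Set G.edgeSet, G.IsRainbowCut c R u v

/-- The rainbow disconnection number `rd(G)`: the least `k` such that `G` has a rainbow
disconnection coloring with colors in a set of size `k`. For a finite graph such `k` exist
(give all edges different colors). -/
noncomputable def SimpleGraph.rd {V : Type*} (G : SimpleGraph V) : ℕ :=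
  sInf {k : ℕ | ∃ c : G.edgeSet → Fin k, G.IsRainbowDisconnectionColoring c}

/-- The graph on `V` whose edges are `uv`, the edges `xu` and `xv` for all `x ∉ {u, v, w}`, and
`wy`. -/
def SimpleGraph.extremalGraph {V : Type*} (u v w y : V) : SimpleGraph V :=
  SimpleGraph.fromRel fun a b =>
    (a = u ∧ b = v) ∨ ((a ≠ u ∧ a ≠ v ∧ a ≠ w) ∧ (b = u ∨ b = v)) ∨ (a = w ∧ b = y)

/-! Lower bounds. A rainbow cut contains an edge cut with at most `rd` edges, so any two vertices
are separated by a cut of size at most `k = G.rd` in `G` and by one of size at most `k' = Gᶜ.rd` in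
`Gᶜ`. The two degrees of a vertex add up to `n - 1`. If `n ≥ k + k' + 3`, every vertex is large,
meaning of degree above `k` in `G` or above `k'` in `Gᶜ`, so two vertices are large in the same
graph, say `G`. Uncrossing minimum cuts gives a cut `S` of size at most `k`, on at most half of the
vertices, with a single vertex `x` large in `G`. All others in `S` are large in `Gᶜ`; but if two
were, a small cut `T` of `Gᶜ` between them would cross `S`, and the pairs separated by both would
outnumber the `k + k'` available edges. So `S` has two vertices, and then the degrees of `x` are too
small (`card_lt_add_three_of_two_le`).

Upper bounds. Colour `G` minus a vertex `z` properly and give each edge `xz` a colour missing at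
`x`: all stars except that of `z` are rainbow, which separates every pair; pendant vertices come for
free (`IsProperOn.rd_le`). Connectedness of the complement lowers the degrees in `G - z`, and
Vizing's theorem gives `rd ≤ n - 2` for both graphs. One more colour is saved in one of them: in
`Gᶜ` if it has two vertices of degree at most one, and otherwise in `G`, by a form of Vizing's
theorem allowing two vertices of degree `k`. Both forms iterate the vertex extension
`IsProperOn.exists_insert`, which rests on Kempe exchanges.

The product bounds follow arithmetically from the sum bounds and positivity. For the extremal
graphs, two adjacent vertices with many common neighbours bound `rd` from below. -/

/-! ### Orbits of two involutions (abstract Kempe chains). -/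

section Involutions

open Function

variable {W : Type*}

/-- The orbit of a fixed point of `s` under the group generated by two involutions `s` and `t`
contains at most one other fixed point of `s`. -/
theorem exists_orbit_of_involutive {s t : W → W} (hs : Involutive s) (ht : Involutive t) {x : W}
    (hx : s x = x) :
    ∃ C : Set W, x ∈ C ∧ (∀ y ∈ C, s y ∈ C) ∧ (∀ y ∈ C, t y ∈ C) ∧
      (∀ D : Set W, x ∈ D → (∀ y ∈ D, s y ∈ D) → (∀ y ∈ D, t y ∈ D) → C ⊆ D) ∧
      ∀ a ∈ C, ∀ b ∈ C, s a = a → s b = b → a ≠ x → b ≠ x → a = b := by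
  set S : Equiv.Perm W := hs.toPerm with hS
  set T : Equiv.Perm W := ht.toPerm with hT
  have hSS : S⁻¹ = S := by ext y; rfl
  have hTT : T⁻¹ = T := by ext y; rfl
  have hSx : S x = x := hx
  -- The orbit is dihedral: `s` sends `(st)^n x` to `(st)^(-n) x`. If `p` is the period of `st` at
  -- `x`, a point fixed by `s` has `p ∣ 2n`, so `n` is `0` or `p/2` modulo `p`.
  have conj : ∀ n : ℤ, S * (S * T) ^ n = (S * T) ^ (-n) * S := by
    intro n
    have h1 : S * (S * T) * S⁻¹ = (S * T)⁻¹ := by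
      have hS1 : S * S = 1 := by nth_rewrite 1 [← hSS]; exact inv_mul_cancel S
      rw [mul_inv_rev, hTT, hSS, ← mul_assoc, hS1, one_mul]
    have h2 := conj_zpow (i := n) (a := S) (b := S * T)
    rw [h1, inv_zpow'] at h2
    rw [h2]; simp [mul_assoc]
  have happ : ∀ n : ℤ, s (((S * T) ^ n) x) = ((S * T) ^ (-n)) x := by
    intro n
    have := congrArg (fun p : Equiv.Perm W => p x) (conj n)
    simp only [Equiv.Perm.mul_apply, hSx] at this
    exact this
  have period : ∀ n : ℤ, ((S * T) ^ n) x = x ↔ ((MulAction.period (S * T) x : ℕ) : ℤ) ∣ n := by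
    intro n
    exact MulAction.zpow_smul_eq_iff_period_dvd (g := S * T) (a := x) (j := n)
  have fixed : ∀ n : ℤ, s (((S * T) ^ n) x) = ((S * T) ^ n) x →
      ((S * T) ^ (2 * n)) x = x := by
    intro n hn
    rw [happ] at hn
    have := congrArg ((S * T) ^ n) hn
    rw [← Equiv.Perm.mul_apply, ← Equiv.Perm.mul_apply, ← zpow_add, ← zpow_add] at this
    rw [two_mul, ← this]; simp
  refine ⟨{y | ∃ n : ℤ, ((S * T) ^ n) x = y}, ⟨0, by simp⟩, ?_, ?_, ?_, ?_⟩
  · rintro _ ⟨n, rfl⟩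
    exact ⟨-n, (happ n).symm⟩
  · rintro _ ⟨n, rfl⟩
    refine ⟨-(n + 1), ?_⟩
    rw [← happ, add_comm, zpow_add, zpow_one]
    change S ((S * T * (S * T) ^ n) x) = T (((S * T) ^ n) x)
    simp only [Equiv.Perm.mul_apply]
    exact hs _
  · rintro D hxD hsD htD _ ⟨n, rfl⟩
    induction n with
    | zero => simpa using hxD
    | succ n ih =>
      rw [add_comm, zpow_add, zpow_one]
      exact hsD _ (htD _ ih)
    | pred n ih =>
      rw [sub_eq_add_neg, add_comm, zpow_add, zpow_neg_one, mul_inv_rev, hTT, hSS]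
      exact htD _ (hsD _ ih)
  · rintro _ ⟨i, rfl⟩ _ ⟨j, rfl⟩ hi hj hix hjx
    have hi2 := (period _).1 (fixed i hi)
    have hj2 := (period _).1 (fixed j hj)
    rw [Ne, period] at hix hjx
    have hij : ((MulAction.period (S * T) x : ℕ) : ℤ) ∣ i - j := by
      obtain ⟨a, ha⟩ := hi2
      obtain ⟨b, hb⟩ := hj2
      rcases Int.even_or_odd' a with ⟨a', rfl | rfl⟩
      · exact absurd ⟨a', by linarith⟩ hix
      rcases Int.even_or_odd' b with ⟨b', rfl | rfl⟩
      · exact absurd ⟨b', by linarith⟩ hjx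
      exact ⟨a' - b', by linarith⟩
    have := (period _).2 hij
    have h2 := congrArg ((S * T) ^ j) this
    rwa [← Equiv.Perm.mul_apply, ← zpow_add, add_sub_cancel] at h2

open Finset

/-- If `s` fixes more marked points in `X` than `t` does in `Y`, some set closed under `s` and `t`
has a surplus of one or two. -/
theorem exists_closed_surplus [DecidableEq W] [Fintype W] {s t : W → W} (hs : Involutive s)
    (ht : Involutive t)
    {X Y : Finset W} (hX : ∀ x ∈ X, s x = x) (hXY : #Y < #X) :
    ∃ C : Finset W, (∀ y ∈ C, s y ∈ C) ∧ (∀ y ∈ C, t y ∈ C) ∧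
      #(Y ∩ C) < #(X ∩ C) ∧ #(X ∩ C) ≤ #(Y ∩ C) + 2 := by
  classical
  obtain ⟨C, hC, hmin⟩ := exists_min_image
    (univ.filter fun C : Finset W => (∀ y ∈ C, s y ∈ C) ∧ (∀ y ∈ C, t y ∈ C) ∧
      #(Y ∩ C) < #(X ∩ C)) card ⟨univ, by simpa using hXY⟩
  simp only [mem_filter, mem_univ, true_and] at hC hmin
  obtain ⟨hsC, htC, hlt⟩ := hC
  refine ⟨C, hsC, htC, hlt, ?_⟩
  obtain ⟨x, hx⟩ : (X ∩ C).Nonempty := card_pos.1 (by omega)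
  rw [mem_inter] at hx
  obtain ⟨D, hxD, hsD, htD, hDmin, hDfix⟩ := exists_orbit_of_involutive hs ht (hX x hx.1)
  have hDC : D.toFinset ⊆ C := by
    intro y hy
    exact hDmin (C : Set W) hx.2 hsC htC (by simpa using hy)
  have hD2 : #(X ∩ D.toFinset) ≤ 2 := by
    have hsub : #((X ∩ D.toFinset).erase x) ≤ 1 := by
      rw [card_le_one]
      intro a ha b hb
      simp only [mem_erase, mem_inter, Set.mem_toFinset] at ha hb
      exact hDfix a ha.2.2 b hb.2.2 (hX a ha.2.1) (hX b hb.2.1) ha.1 hb.1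
    have := pred_card_le_card_erase (a := x) (s := X ∩ D.toFinset)
    omega
  by_cases hD : #(Y ∩ D.toFinset) < #(X ∩ D.toFinset)
  · have hle := hmin D.toFinset ⟨by simpa using hsD, by simpa using htD, hD⟩
    have : D.toFinset = C := eq_of_subset_of_card_le hDC hle
    rw [this] at hD2
    omega
  -- An orbit without surplus can be deleted: the smaller closed set `C \ D` keeps a surplus,
  -- against the minimality of `C`.
  · exfalso
    have hsplit : ∀ Z : Finset W, #(Z ∩ (C \ D.toFinset)) + #(Z ∩ D.toFinset) = #(Z ∩ C) := by
      intro Z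
      rw [← card_union_of_disjoint]
      · congr 1
        rw [← inter_union_distrib_left, sdiff_union_of_subset hDC]
      · exact (disjoint_sdiff_self_left (x := D.toFinset) (y := C)).mono inter_subset_right
          inter_subset_right
    have hX' := hsplit X
    have hY' := hsplit Y
    have hle := hmin (C \ D.toFinset) ⟨?_, ?_, by omega⟩
    · have h1 := card_sdiff_add_card_eq_card hDC
      have h2 : 0 < #D.toFinset := card_pos.2 ⟨x, by simpa using hxD⟩
      omega
    · intro y hy
      simp only [mem_sdiff, Set.mem_toFinset] at hy ⊢
      exact ⟨hsC y hy.1, fun h => hy.2 (by simpa [hs y] using hsD _ h)⟩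
    · intro y hy
      simp only [mem_sdiff, Set.mem_toFinset] at hy ⊢
      exact ⟨htC y hy.1, fun h => hy.2 (by simpa [ht y] using htD _ h)⟩

end Involutions

/-! ### Kempe exchanges and balancing. -/

section Kempe

open Function Finset

variable {W K : Type*} [DecidableEq W] [DecidableEq K]

/-- A family `σ` of involutions (the colour classes of an edge-colouring, seen as partial
matchings) covering the same edges as `σ₀`, with a choice `X i ⊆ N` of points
missed by the colour `i`, such that `u ∈ N` is chosen by `m u` colours of `T`. -/
structure KempeState (T : Finset K) (N : Finset W) (m : W → ℕ) (σ₀ σ : K → W → W)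
    (X : K → Finset W) : Prop where
  inv : ∀ i, Involutive (σ i)
  off : ∀ i, i ∉ T → σ i = σ₀ i
  cover : ∀ i ∈ T, ∀ x, ∃ j ∈ T, σ j x = σ₀ i x
  fix : ∀ i ∈ T, ∀ x ∈ X i, σ i x = x
  sub : ∀ i ∈ T, X i ⊆ N
  count : ∀ u ∈ N, #{i ∈ T | u ∈ X i} = m u

variable {T : Finset K} {N : Finset W} {m : W → ℕ} {σ₀ σ : K → W → W} {X : K → Finset W}

/-- Exchange the colours `i` and `j` on a set closed under both. -/
theorem KempeState.exchange (h : KempeState T N m σ₀ σ X) {i j : K} (hi : i ∈ T) (hj : j ∈ T)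
    {C : Finset W} (hiC : ∀ y ∈ C, σ i y ∈ C) (hjC : ∀ y ∈ C, σ j y ∈ C) :
    KempeState T N m σ₀ (fun l x => if x ∈ C then σ (Equiv.swap i j l) x else σ l x)
      (fun l => X (Equiv.swap i j l) ∩ C ∪ X l \ C) := by
  have hT : ∀ l, Equiv.swap i j l ∈ T ↔ l ∈ T := by
    intro l
    by_cases h1 : l = i
    · subst h1; simp [hi, hj]
    by_cases h2 : l = j
    · subst h2; simp [hi, hj]
    rw [Equiv.swap_apply_of_ne_of_ne h1 h2]
  have hcl : ∀ l, l = i ∨ l = j → ∀ y, y ∈ C ↔ σ l y ∈ C := by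
    rintro l (rfl | rfl) y
    · exact ⟨hiC y, fun hy => by simpa [h.inv l y] using hiC _ hy⟩
    · exact ⟨hjC y, fun hy => by simpa [h.inv l y] using hjC _ hy⟩
  have hmem : ∀ l x, x ∈ X (Equiv.swap i j l) ∩ C ∪ X l \ C ↔
      if x ∈ C then x ∈ X (Equiv.swap i j l) else x ∈ X l := by
    intro l x
    by_cases hx : x ∈ C <;> simp [hx]
  refine ⟨?_, ?_, ?_, ?_, ?_, ?_⟩
  · intro l x
    by_cases hl : l = i ∨ l = j
    · have hl' : Equiv.swap i j l = i ∨ Equiv.swap i j l = j := by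
        rcases hl with rfl | rfl <;> simp
      by_cases hx : x ∈ C
      · have := (hcl _ hl' x).1 hx
        simp only [hx, this, if_true]
        exact h.inv _ x
      · have : σ l x ∉ C := fun hh => hx ((hcl _ hl x).2 hh)
        simp only [hx, this, if_false]
        exact h.inv _ x
    · push Not at hl
      simp only [Equiv.swap_apply_of_ne_of_ne hl.1 hl.2, ite_self]
      exact h.inv _ x
  · intro l hl
    have h1 : l ≠ i := fun e => hl (e ▸ hi)
    have h2 : l ≠ j := fun e => hl (e ▸ hj)
    funext x
    simp only [Equiv.swap_apply_of_ne_of_ne h1 h2, ite_self, h.off l hl]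
  · intro l hl x
    obtain ⟨l', hl', he⟩ := h.cover l hl x
    by_cases hx : x ∈ C
    · exact ⟨Equiv.swap i j l', (hT _).2 hl', by simp [hx, he]⟩
    · exact ⟨l', hl', by simp [hx, he]⟩
  · intro l hl x hx
    rw [hmem] at hx
    by_cases hxC : x ∈ C
    · simp only [hxC, if_true] at hx ⊢
      exact h.fix _ ((hT l).2 hl) x hx
    · simp only [hxC, if_false] at hx ⊢
      exact h.fix _ hl x hx
  · intro l hl x hx
    rw [hmem] at hx
    split_ifs at hx
    · exact h.sub _ ((hT l).2 hl) hx
    · exact h.sub _ hl hx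
  · intro u hu
    rw [← h.count u hu]
    simp only [hmem]
    by_cases hx : u ∈ C
    · simp only [hx, if_true]
      refine card_bij (fun l _ => Equiv.swap i j l) ?_ ?_ ?_
      · intro l hl
        simp only [mem_filter] at hl ⊢
        exact ⟨(hT l).2 hl.1, hl.2⟩
      · intro a _ b _ hab
        exact (Equiv.swap i j).injective hab
      · intro l hl
        simp only [mem_filter] at hl
        exact ⟨Equiv.swap i j l, by simp [hT, hl.1, hl.2], by simp⟩
    · simp only [hx, if_false]

/-- Exchanging colours, the missed points can be spread evenly over the colours. -/
theorem KempeState.exists_balanced [Fintype W] (h : KempeState T N m σ₀ σ X) :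
    ∃ σ' X', KempeState T N m σ₀ σ' X' ∧ ∀ i ∈ T, ∀ j ∈ T, #(X' i) ≤ #(X' j) + 2 := by
  classical
  -- Minimise the sum of squares: moving a surplus `d ≤ 2` between sizes `a ≥ b + 3` lowers it by
  -- `2d(a - b - d) > 0`.
  let P : ℕ → Prop := fun n => ∃ σ' X', KempeState T N m σ₀ σ' X' ∧ ∑ l ∈ T, #(X' l) ^ 2 = n
  have hP : ∃ n, P n := ⟨_, σ, X, h, rfl⟩
  obtain ⟨σ', X', h', hn⟩ := Nat.find_spec hP
  refine ⟨σ', X', h', fun i hi j hj => ?_⟩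
  by_contra! hlt
  have hij : i ≠ j := by rintro rfl; omega
  obtain ⟨C, hiC, hjC, h1, h2⟩ := exists_closed_surplus (h'.inv i) (h'.inv j) (h'.fix i hi)
    (show #(X' j) < #(X' i) by omega)
  have hmin := Nat.find_min' hP ⟨_, _, h'.exchange hi hj hiC hjC, rfl⟩
  rw [← hn] at hmin
  have hcard : ∀ A B : Finset W, #(A ∩ C ∪ B \ C) = #(A ∩ C) + #(B \ C) := by
    intro A B
    exact card_union_of_disjoint (disjoint_sdiff.mono_left inter_subset_right)
  have hjT : j ∈ T.erase i := mem_erase.2 ⟨hij.symm, hj⟩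
  rw [← add_sum_erase _ _ hi, ← add_sum_erase _ _ hi, ← add_sum_erase _ _ hjT,
    ← add_sum_erase _ _ hjT] at hmin
  have hrest : ∀ l ∈ (T.erase i).erase j,
      #(X' (Equiv.swap i j l) ∩ C ∪ X' l \ C) ^ 2 = #(X' l) ^ 2 := by
    intro l hl
    simp only [mem_erase] at hl
    rw [Equiv.swap_apply_of_ne_of_ne hl.2.1 hl.1, hcard, card_inter_add_card_sdiff]
  rw [sum_congr rfl hrest] at hmin
  simp only [Equiv.swap_apply_left, Equiv.swap_apply_right, hcard] at hmin
  have e1 := card_inter_add_card_sdiff (X' i) C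
  have e2 := card_inter_add_card_sdiff (X' j) C
  rw [← e1, ← e2] at hmin hlt
  nlinarith

end Kempe

/-! ### Distinct missed colours. -/

section Kempe

open Function Finset

variable {W K : Type*} [DecidableEq W] [DecidableEq K]

/-- If at most `#T` points miss two colours of `T` each, one of them possibly only one, then after
exchanging colours the points can be assigned distinct colours that they miss. -/
theorem exists_distinct_missed_colors [Fintype W] (k₀ : K) (n : ℕ) (T : Finset K) (N : Finset W)
    (σ₀ : K → W → W) (X : K → Finset W) (u₀ : W) (hT : #T = n) (hN : #N ≤ n)
    (hinv : ∀ i, Involutive (σ₀ i)) (hfix : ∀ i ∈ T, ∀ x ∈ X i, σ₀ i x = x)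
    (htwo : ∀ u ∈ N, u ≠ u₀ → 2 ≤ #{i ∈ T | u ∈ X i}) (hone : ∀ u ∈ N, 1 ≤ #{i ∈ T | u ∈ X i}) :
    ∃ (σ : K → W → W) (f : W → K), (∀ i, Involutive (σ i)) ∧ (∀ i, i ∉ T → σ i = σ₀ i) ∧
      (∀ i ∈ T, ∀ x, ∃ j ∈ T, σ j x = σ₀ i x) ∧ (∀ u ∈ N, f u ∈ T ∧ σ (f u) u = u) ∧
      Set.InjOn f N := by
  classical
  induction n generalizing T N σ₀ X u₀ with
  | zero =>
    obtain rfl : N = ∅ := card_eq_zero.1 (by omega)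
    obtain rfl : T = ∅ := card_eq_zero.1 hT
    exact ⟨σ₀, fun _ => k₀, hinv, by simp, by simp, by simp, by simp⟩
  | succ n ih =>
    have hK : T.Nonempty := card_pos.1 (by omega)
    obtain ⟨k, hk⟩ := hK
    rcases N.eq_empty_or_nonempty with rfl | ⟨v, hv⟩
    · exact ⟨σ₀, fun _ => k, hinv, by simp, fun i hi x => ⟨i, hi, rfl⟩, by simp, by simp⟩
    obtain ⟨u₁, hu₁, hu₁'⟩ : ∃ u₁ ∈ N, ∀ u ∈ N, u ≠ u₁ → 2 ≤ #{i ∈ T | u ∈ X i} := by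
      by_cases h : u₀ ∈ N
      · exact ⟨u₀, h, htwo⟩
      · exact ⟨v, hv, fun u hu _ => htwo u hu (fun e => h (e ▸ hu))⟩
    -- Exactly one point keeps a single missed colour, which makes the total of the sizes odd.
    let m : W → ℕ := fun u => if u = u₁ then 1 else 2
    have hm : ∀ u, ∃ F : Finset K, u ∈ N → F ⊆ {i ∈ T | u ∈ X i} ∧ #F = m u := by
      intro u
      by_cases hu : u ∈ N
      · have : m u ≤ #{i ∈ T | u ∈ X i} := by
          by_cases h : u = u₁
          · simpa [m, h] using hone u₁ hu₁
          · simpa [m, h] using hu₁' u hu h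
        obtain ⟨F, hF⟩ := exists_subset_card_eq this
        exact ⟨F, fun _ => hF⟩
      · exact ⟨∅, fun h => absurd h hu⟩
    choose F hF using hm
    have hst : KempeState T N m σ₀ σ₀ (fun i => {u ∈ N | i ∈ F u}) := by
      refine ⟨hinv, fun _ _ => rfl, fun i hi x => ⟨i, hi, rfl⟩, ?_, fun i _ => filter_subset _ _, ?_⟩
      · intro i hi x hx
        rw [mem_filter] at hx
        have := (hF x hx.1).1 hx.2
        rw [mem_filter] at this
        exact hfix i hi x this.2
      · intro u hu
        rw [← (hF u hu).2]
        congr 1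
        ext i
        have hsub : i ∈ F u → i ∈ ({i ∈ T | u ∈ X i} : Finset K) := fun h => (hF u hu).1 h
        simp only [mem_filter] at hsub ⊢
        tauto
    obtain ⟨σ, Y, hY, hbal⟩ := hst.exists_balanced
    have hsum : ∑ i ∈ T, #(Y i) = 2 * (#N - 1) + 1 := by
      have h1 : ∑ i ∈ T, #(Y i) = ∑ u ∈ N, #{i ∈ T | u ∈ Y i} := by
        have := sum_card_bipartiteAbove_eq_sum_card_bipartiteBelow (s := T) (t := N)
          (fun i u => u ∈ Y i)
        simp only [bipartiteAbove, bipartiteBelow] at this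
        rw [← this]
        refine sum_congr rfl fun i hi => ?_
        congr 1
        ext u
        have hsub : u ∈ Y i → u ∈ N := fun h => hY.sub i hi h
        simp only [mem_filter]
        tauto
      rw [h1, sum_congr rfl hY.count, ← add_sum_erase _ _ hu₁, sum_congr rfl (g := fun _ => 2)]
      · simp [card_erase_of_mem hu₁]; ring
      · intro u hu
        simp [(mem_erase.1 hu).1]
    have hNpos : 0 < #N := card_pos.2 ⟨v, hv⟩
    -- The total is below `2 * #T`, so some size is below two. Were none equal to one, that size
    -- would be zero and, by balance, all would be zero or two, against the odd total.
    obtain ⟨i, hi, hi1⟩ : ∃ i ∈ T, #(Y i) = 1 := by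
      by_contra! hne
      have hex : ∃ i ∈ T, #(Y i) < 2 := by
        by_contra! hge
        have := card_nsmul_le_sum T (fun i => #(Y i)) 2 hge
        simp only [smul_eq_mul] at this
        omega
      obtain ⟨i, hi, hi2⟩ := hex
      have hi0 : #(Y i) = 0 := by have := hne i hi; omega
      have : Even (∑ i ∈ T, #(Y i)) := by
        refine even_sum _ fun j hj => ?_
        have h1 := hbal j hj i hi
        have h2 := hne j hj
        have : #(Y j) = 0 ∨ #(Y j) = 2 := by omega
        rcases this with h | h <;> rw [h] <;> decide
      rw [hsum] at this
      exact absurd this (by simp [parity_simps])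
    obtain ⟨u, hu⟩ := card_eq_one.1 hi1
    have huN : u ∈ N := hY.sub i hi (by simp [hu])
    have hcount : ∀ w ∈ N.erase u, #{j ∈ T.erase i | w ∈ Y j} = m w := by
      intro w hw
      rw [mem_erase] at hw
      rw [← hY.count w hw.2]
      congr 1
      ext j
      simp only [mem_filter, mem_erase]
      refine ⟨fun h => ⟨h.1.2, h.2⟩, fun h => ⟨⟨?_, h.1⟩, h.2⟩⟩
      rintro rfl
      exact hw.1 (by simpa [hu] using h.2)
    -- Colour `i` is reserved for `u`. No other point had chosen it, so the counts survive its
    -- removal, and later exchanges leave it untouched.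
    obtain ⟨τ, f, h1, h2, h3, h4, h5⟩ := ih (T.erase i) (N.erase u) σ Y u₁
      (by rw [card_erase_of_mem hi]; omega) (by rw [card_erase_of_mem huN]; omega) hY.inv
      (fun j hj => hY.fix j (mem_of_mem_erase hj))
      (fun w hw hne => by rw [hcount w hw]; simp [m, hne])
      (fun w hw => by rw [hcount w hw]; simp only [m]; split_ifs <;> simp)
    refine ⟨τ, update f u i, h1, ?_, ?_, ?_, ?_⟩
    · intro j hj
      rw [h2 j (fun h => hj (mem_of_mem_erase h)), hY.off j hj]
    · intro j hj x
      obtain ⟨l, hl, he⟩ := hY.cover j hj x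
      by_cases hli : l = i
      · subst hli
        exact ⟨l, hl, by rw [h2 l (by simp), he]⟩
      · obtain ⟨l', hl', he'⟩ := h3 l (mem_erase.2 ⟨hli, hl⟩) x
        exact ⟨l', mem_of_mem_erase hl', he'.trans he⟩
    · intro w hw
      by_cases hwu : w = u
      · subst hwu
        simp only [update_self]
        exact ⟨hi, by rw [h2 i (by simp)]; exact hY.fix i hi w (by simp [hu])⟩
      · rw [update_of_ne hwu]
        have := h4 w (mem_erase.2 ⟨hwu, hw⟩)
        exact ⟨mem_of_mem_erase this.1, this.2⟩
    · intro a ha b hb hab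
      have hne : ∀ w ∈ N, w ≠ u → f w ≠ i := fun w hw hwu =>
        (mem_erase.1 (h4 w (mem_erase.2 ⟨hwu, hw⟩)).1).1
      by_cases hau : a = u <;> by_cases hbu : b = u
      · rw [hau, hbu]
      · subst hau
        rw [update_self, update_of_ne hbu] at hab
        exact absurd hab.symm (hne b hb hbu)
      · subst hbu
        rw [update_self, update_of_ne hau] at hab
        exact absurd hab (hne a ha hau)
      · rw [update_of_ne hbu, update_of_ne hau] at hab
        exact h5 (by simpa [hau] using ha) (by simpa [hbu] using hb) hab

end Kempe

/-! ### Vizing's theorem by vertex extension. -/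

namespace SimpleGraph

open Finset

variable {V : Type*}

open Classical in
/-- The number of neighbours of `x` in `A`. -/
noncomputable def degreeOn (G : SimpleGraph V) (A : Finset V) (x : V) : ℕ := #{y ∈ A | G.Adj x y}

/-- `c` is a proper edge-colouring of the subgraph of `G` induced on `A`. -/
structure IsProperOn {K : Type*} (G : SimpleGraph V) (A : Finset V) (c : V → V → K) : Prop where
  symm : ∀ x y, c x y = c y x
  inj : ∀ x ∈ A, ∀ y ∈ A, ∀ y' ∈ A, G.Adj x y → G.Adj x y' → c x y = c x y' → y = y'

variable {G : SimpleGraph V} {A B : Finset V} {k : ℕ}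

theorem degreeOn_mono (h : A ⊆ B) (x : V) : G.degreeOn A x ≤ G.degreeOn B x :=
  by classical exact card_le_card (filter_subset_filter _ h)

theorem degreeOn_insert_of_adj [DecidableEq V] {x v : V} (hv : v ∉ A) (h : G.Adj x v) :
    G.degreeOn (insert v A) x = G.degreeOn A x + 1 := by
  classical
  unfold degreeOn
  convert card_insert_of_notMem (s := {y ∈ A | G.Adj x y}) (a := v) (by simp [hv]) using 2
  rw [filter_insert, if_pos h]

theorem exists_color_ne_of_degreeOn_lt (c : V → V → Fin k) {x : V} (h : G.degreeOn A x < k) :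
    ∃ i, ∀ y ∈ A, G.Adj x y → c x y ≠ i := by
  classical
  by_contra! hne
  have hsub : (univ : Finset (Fin k)) ⊆ image (c x) {y ∈ A | G.Adj x y} := by
    intro i _
    obtain ⟨y, hy, hxy, rfl⟩ := hne i
    exact mem_image_of_mem _ (by simp [hy, hxy])
  have := (card_le_card hsub).trans card_image_le
  rw [card_univ, Fintype.card_fin] at this
  unfold degreeOn at h
  omega

/-- A proper edge-colouring with `k` colours extends to a new vertex `v` of degree at most `k` if
the neighbours of `v` have degree at most `k`, with at most one equality. -/
theorem IsProperOn.exists_insert [Fintype V] [DecidableEq V] {c : V → V → Fin k}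
    (hc : G.IsProperOn A c)
    {v : V} (u₀ : V) (hdeg : G.degreeOn A v ≤ k)
    (htwo : ∀ u ∈ A, G.Adj v u → u ≠ u₀ → G.degreeOn A u + 2 ≤ k)
    (hone : ∀ u ∈ A, G.Adj v u → G.degreeOn A u + 1 ≤ k) :
    ∃ c' : V → V → Fin k, G.IsProperOn (insert v A) c' := by
  classical
  by_cases hv : v ∈ A
  · rw [insert_eq_of_mem hv]
    exact ⟨c, hc⟩
  -- Colour class `i` as an involution: `z` is the partner of `x` along colour `i`, or `x` itself
  -- when `x` misses `i`.
  have hex : ∀ (i : Fin k) (x : V), ∃ z,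
      (∀ y, x ∈ A → y ∈ A → G.Adj x y → c x y = i → z = y) ∧
      (z ≠ x → x ∈ A ∧ z ∈ A ∧ G.Adj x z ∧ c x z = i) := by
    intro i x
    by_cases h : x ∈ A ∧ ∃ y ∈ A, G.Adj x y ∧ c x y = i
    · obtain ⟨hx, y, hy, hxy, rfl⟩ := h
      exact ⟨y, fun y' _ hy' hxy' he => hc.inj x hx y hy y' hy' hxy hxy' he.symm,
        fun _ => ⟨hx, hy, hxy, rfl⟩⟩
    · exact ⟨x, fun y hx hy hxy he => absurd ⟨hx, y, hy, hxy, he⟩ h, fun h => absurd rfl h⟩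
  choose s hs hs' using hex
  have hinv : ∀ i, Function.Involutive (s i) := by
    intro i x
    by_cases hx : s i x = x
    · rw [hx, hx]
    · obtain ⟨h1, h2, h3, h4⟩ := hs' i x hx
      exact hs i (s i x) x h2 h1 h3.symm (by rw [hc.symm, h4])
  have hcount : ∀ (u : V), k ≤ #{i : Fin k | s i u = u} + G.degreeOn A u := by
    intro u
    have h1 := card_filter_add_card_filter_not (s := (univ : Finset (Fin k)))
      (fun i => s i u = u)
    have h2 : #{i : Fin k | ¬ s i u = u} ≤ G.degreeOn A u := by
      refine (card_le_card (t := image (c u) {y ∈ A | G.Adj u y}) fun i hi => ?_).trans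
        card_image_le
      simp only [mem_filter, mem_univ, true_and] at hi
      obtain ⟨-, h2, h3, h4⟩ := hs' i u hi
      exact mem_image.2 ⟨s i u, by simp [h2, h3], h4⟩
    rw [card_univ, Fintype.card_fin] at h1
    omega
  have hmemN : ∀ u, u ∈ ({u ∈ A | G.Adj v u} : Finset V) → ∀ i : Fin k,
      (u ∈ ({u ∈ A | G.Adj v u ∧ s i u = u} : Finset V) ↔ s i u = u) := by
    intro u hu i
    simp only [mem_filter] at hu ⊢
    tauto
  obtain ⟨σ, f, h1, -, h3, h4, h5⟩ := exists_distinct_missed_colors (c v v) k univ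
    {u ∈ A | G.Adj v u} s (fun i => {u ∈ A | G.Adj v u ∧ s i u = u}) u₀ (by simp) hdeg hinv
    (fun i _ x hx => (mem_filter.1 hx).2.2)
    (fun u hu hne => by
      simp only [hmemN u hu]
      have := htwo u (mem_filter.1 hu).1 (mem_filter.1 hu).2 hne
      have := hcount u
      omega)
    (fun u hu => by
      simp only [hmemN u hu]
      have := hone u (mem_filter.1 hu).1 (mem_filter.1 hu).2
      have := hcount u
      omega)
  have : Nonempty (Fin k) := ⟨c v v⟩
  -- The new colour of an edge is read back from the involutions; the cover property ensures that
  -- there is one.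
  let d : V → V → Fin k := fun x y => Classical.epsilon fun i => σ i x = y
  have hd : ∀ x ∈ A, ∀ y ∈ A, G.Adj x y → σ (d x y) x = y := by
    intro x hx y hy hxy
    obtain ⟨j, -, hj⟩ := h3 (c x y) (mem_univ _) x
    exact Classical.epsilon_spec (p := fun i => σ i x = y)
      ⟨j, hj.trans (hs (c x y) x y hx hy hxy rfl)⟩
  refine ⟨fun x y => if x = v then f y else if y = v then f x else d x y, ?_, ?_⟩
  · intro x y
    by_cases hx : x = v <;> by_cases hy : y = v <;> simp only [hx, hy, if_true, if_false]
    simp only [d]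
    congr 1
    funext i
    refine propext ⟨?_, ?_⟩ <;> rintro rfl <;> exact h1 i _
  · intro x hx y hy y' hy' hxy hxy' he
    rw [mem_insert] at hx hy hy'
    by_cases hxv : x = v
    · subst hxv
      simp only [if_true] at he
      have hyA := hy.resolve_left hxy.ne'
      have hyA' := hy'.resolve_left hxy'.ne'
      exact h5 (by simp [hyA, hxy]) (by simp [hyA', hxy']) he
    · have hxA := hx.resolve_left hxv
      simp only [hxv, if_false] at he
      have key : ∀ z ∈ A, G.Adj x z → G.Adj x v → f x ≠ d x z := by
        intro z hz hxz hxv' hfd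
        have e1 := hd x hxA z hz hxz
        rw [← hfd, (h4 x (by simp [hxA, hxv'.symm])).2] at e1
        exact hxz.ne e1
      by_cases hyv : y = v <;> by_cases hyv' : y' = v
      · rw [hyv, hyv']
      · subst hyv
        simp only [hyv', if_true, if_false] at he
        exact absurd he (key y' (hy'.resolve_left hyv') hxy' hxy)
      · subst hyv'
        simp only [hyv, if_true, if_false] at he
        exact absurd he.symm (key y (hy.resolve_left hyv) hxy hxy')
      · simp only [hyv, hyv', if_false] at he
        rw [← hd x hxA y (hy.resolve_left hyv) hxy, he,
          hd x hxA y' (hy'.resolve_left hyv') hxy']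

/-- Vizing's theorem. -/
theorem exists_isProperOn_of_degreeOn_lt [Fintype V] [NeZero k] (A : Finset V)
    (h : ∀ x ∈ A, G.degreeOn A x < k) :
    ∃ c : V → V → Fin k, G.IsProperOn A c := by
  classical
  induction A using Finset.induction_on with
  | empty => exact ⟨fun _ _ => 0, fun _ _ => rfl, by simp⟩
  | insert v B hv ih =>
    have hmono := fun x => G.degreeOn_mono (subset_insert v B) x
    obtain ⟨c, hc⟩ := ih fun x hx => (hmono x).trans_lt (h x (mem_insert_of_mem hx))
    have key : ∀ u ∈ B, G.Adj v u → G.degreeOn B u + 2 ≤ k := by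
      intro u hu hvu
      have := h u (mem_insert_of_mem hu)
      rw [degreeOn_insert_of_adj hv hvu.symm] at this
      omega
    exact hc.exists_insert v ((hmono v).trans (h v (mem_insert_self v B)).le)
      (fun u hu hvu _ => key u hu hvu) (fun u hu hvu => by have := key u hu hvu; omega)

/-- A graph of maximum degree at most `k`, with at most two vertices of degree `k`, has a proper
edge-colouring with `k` colours. -/
theorem exists_isProperOn_of_degreeOn_le [Fintype V] [NeZero k] (A : Finset V) (f₁ f₂ : V)
    (hle : ∀ x ∈ A, G.degreeOn A x ≤ k)
    (hlt : ∀ x ∈ A, x ≠ f₁ → x ≠ f₂ → G.degreeOn A x < k) :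
    ∃ c : V → V → Fin k, G.IsProperOn A c := by
  classical
  have step : ∀ (B : Finset V) (v u₀ : V) (c : V → V → Fin k), v ∈ A → B ⊆ A →
      G.IsProperOn B c → (∀ x ∈ B, x ≠ u₀ → G.degreeOn A x < k) →
      ∃ c : V → V → Fin k, G.IsProperOn (insert v B) c := by
    intro B v u₀ c hv hB hc hBlt
    by_cases hvB : v ∈ B
    · exact ⟨c, by rwa [insert_eq_of_mem hvB]⟩
    have hsub : insert v B ⊆ A := insert_subset hv hB
    have hins : ∀ u, G.Adj v u → G.degreeOn B u + 1 ≤ G.degreeOn A u := by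
      intro u hvu
      rw [← degreeOn_insert_of_adj hvB hvu.symm]
      exact degreeOn_mono hsub u
    refine hc.exists_insert u₀ ((degreeOn_mono hB v).trans (hle v hv)) ?_ ?_
    · intro u hu hvu hne
      have := hBlt u hu hne
      have := hins u hvu
      omega
    · intro u hu hvu
      have := hle u (hB hu)
      have := hins u hvu
      omega
  have hBA : A \ {f₁, f₂} ⊆ A := sdiff_subset
  have hB : ∀ x ∈ A \ {f₁, f₂}, G.degreeOn A x < k := by
    intro x hx
    simp only [mem_sdiff, mem_insert, mem_singleton, not_or] at hx
    exact hlt x hx.1 hx.2.1 hx.2.2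
  obtain ⟨c, hc⟩ := exists_isProperOn_of_degreeOn_lt (G := G) (k := k) (A \ {f₁, f₂})
    fun x hx => (degreeOn_mono hBA x).trans_lt (hB x hx)
  have hc₁ : ∃ c : V → V → Fin k, G.IsProperOn (A \ {f₂}) c := by
    by_cases h : f₁ ∈ A \ {f₂}
    · obtain ⟨c, hc⟩ := step _ f₁ f₁ c (mem_sdiff.1 h).1 hBA hc fun x hx _ => hB x hx
      refine ⟨c, ?_⟩
      convert hc using 1
      ext x
      by_cases hx : x = f₁
      · subst hx; simpa using h
      · simp [hx]
    · refine ⟨c, ?_⟩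
      convert hc using 1
      ext x
      by_cases hx : x = f₁
      · subst hx; simpa using h
      · simp [hx]
  obtain ⟨c₁, hc₁⟩ := hc₁
  by_cases h : f₂ ∈ A
  -- With `f₂` inserted last, `f₁` is the only possible neighbour of full degree, the one exception
  -- that the extension allows.
  · obtain ⟨c, hc⟩ := step _ f₂ f₁ c₁ h sdiff_subset hc₁ fun x hx hne => by
      simp only [mem_sdiff, mem_singleton] at hx
      exact hlt x hx.1 hne hx.2
    refine ⟨c, ?_⟩
    convert hc using 1
    ext x
    by_cases hx : x = f₂
    · subst hx; simpa using h
    · simp [hx]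
  · refine ⟨c₁, ?_⟩
    convert hc₁ using 1
    ext x
    by_cases hx : x = f₂
    · subst hx; simpa using h
    · simp [hx]

end SimpleGraph

/-! ### Rainbow cuts, edge cuts and proper colourings. -/

namespace SimpleGraph

open Finset

variable {V : Type*} {G : SimpleGraph V} {k : ℕ}

theorem exists_adj_of_reachable {u v : V} (h : G.Reachable u v) {S : Set V} (hu : u ∈ S)
    (hv : v ∉ S) : ∃ a ∈ S, ∃ b ∉ S, G.Adj a b := by
  obtain ⟨p⟩ := h
  obtain ⟨d, -, h1, h2⟩ := p.exists_boundary_dart S hu hv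
  exact ⟨_, h1, _, h2, d.adj⟩

/-- To bound `rd`, it suffices to colour the edges so that any two vertices are separated by a
vertex set with rainbow boundary. -/
theorem rd_le_of_cuts (c : V → V → Fin k) (hc : ∀ x y, c x y = c y x)
    (h : ∀ u v, u ≠ v → ∃ S : Set V, u ∈ S ∧ v ∉ S ∧ ∀ a ∈ S, ∀ b ∉ S, ∀ a' ∈ S, ∀ b' ∉ S,
      G.Adj a b → G.Adj a' b' → c a b = c a' b' → a = a' ∧ b = b') : G.rd ≤ k := by
  refine Nat.sInf_le ⟨fun e => Sym2.lift ⟨c, hc⟩ e.1, fun u v huv => ?_⟩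
  obtain ⟨S, hu, hv, hS⟩ := h u v huv
  refine ⟨{e | ∃ a ∈ S, ∃ b ∉ S, e.1 = s(a, b)}, ?_, fun hr => ?_⟩
  · rintro ⟨e, he⟩ ⟨a, ha, b, hb, rfl⟩ ⟨e', he'⟩ ⟨a', ha', b', hb', rfl⟩ heq
    obtain ⟨rfl, rfl⟩ := hS a ha b hb a' ha' b' hb' he he' heq
    rfl
  · obtain ⟨a, ha, b, hb, hab⟩ := exists_adj_of_reachable hr hu hv
    rw [deleteEdges_adj] at hab
    exact hab.2 ⟨⟨s(a, b), hab.1⟩, ⟨a, ha, b, hb, rfl⟩, rfl⟩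

open Classical in
/-- The number of edges of `G` leaving `S`. -/
noncomputable def cutSize [Fintype V] (G : SimpleGraph V) (S : Finset V) : ℕ :=
  #(G.interedges S Sᶜ)

theorem exists_isRainbowDisconnectionColoring_rd [Finite V] (G : SimpleGraph V) :
    ∃ c : G.edgeSet → Fin G.rd, G.IsRainbowDisconnectionColoring c := by
  have hne : {k : ℕ | ∃ c : G.edgeSet → Fin k, G.IsRainbowDisconnectionColoring c}.Nonempty := by
    obtain ⟨n, ⟨e⟩⟩ := Finite.exists_equiv_fin G.edgeSet
    refine ⟨n, e, fun u v huv => ⟨Set.univ, e.injective.injOn, fun hr => ?_⟩⟩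
    obtain ⟨a, -, b, -, hab⟩ := exists_adj_of_reachable hr (S := {u}) rfl huv.symm
    simp at hab
  exact Nat.sInf_mem hne

/-- Any two vertices are separated by an edge cut of size at most `rd`. -/
theorem exists_cutSize_le_rd [Fintype V] (G : SimpleGraph V) {u v : V} (huv : u ≠ v) :
    ∃ S : Finset V, u ∈ S ∧ v ∉ S ∧ G.cutSize S ≤ G.rd := by
  classical
  obtain ⟨c, hc⟩ := G.exists_isRainbowDisconnectionColoring_rd
  obtain ⟨R, hR, hsep⟩ := hc u v huv
  set H := G.deleteEdges (Subtype.val '' R) with hH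
  -- The component of `u` in `G - R`: every edge leaving it lies in `R`, hence these edges have
  -- distinct colours.
  set S : Finset V := univ.filter fun x => H.Reachable u x with hS
  refine ⟨S, by simp [hS], by simpa [hS] using hsep, ?_⟩
  have key : ∀ p ∈ G.interedges S Sᶜ,
      ∃ h : G.Adj p.1 p.2, (⟨s(p.1, p.2), h⟩ : G.edgeSet) ∈ R := by
    rintro ⟨a, b⟩ hab
    simp only [mem_interedges_iff, hS, mem_filter, mem_univ, true_and, mem_compl] at hab
    obtain ⟨ha, hb, hab⟩ := hab
    refine ⟨hab, ?_⟩
    by_contra hn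
    refine hb (ha.trans (Adj.reachable ?_))
    rw [hH, deleteEdges_adj]
    refine ⟨hab, ?_⟩
    rintro ⟨e, he, heq⟩
    have : e = ⟨s(a, b), hab⟩ := Subtype.ext heq
    exact hn (this ▸ he)
  unfold cutSize
  choose hadj hmem using key
  rw [← card_attach]
  refine (card_le_card_of_injOn
    (fun p : {p // p ∈ G.interedges S Sᶜ} => c ⟨s(p.1.1, p.1.2), hadj p.1 p.2⟩) (t := univ)
    (fun _ _ => mem_univ _) ?_).trans_eq
    (by simp)
  rintro ⟨⟨a, b⟩, hp⟩ - ⟨⟨a', b'⟩, hq⟩ - he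
  have heq := congrArg Subtype.val (hR (hmem _ hp) (hmem _ hq) he)
  simp only [Sym2.eq_iff] at heq
  rcases heq with ⟨rfl, rfl⟩ | ⟨rfl, rfl⟩
  · rfl
  · simp only [mem_interedges_iff, hS, mem_filter, mem_univ, true_and, mem_compl] at hp hq
    exact absurd hq.1 hp.2.1

/-- A colouring of `G` is rainbow disconnecting if, away from a vertex `z` and a set `L` of
vertices of degree at most one, it is proper, and there is a spare colour for the edges at `z`. -/
theorem IsProperOn.rd_le [Fintype V] [DecidableEq V] {c : V → V → Fin k} (z : V) (L : Finset V)
    (hL : ∀ l ∈ L, ∀ a b, G.Adj l a → G.Adj l b → a = b)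
    (hc : G.IsProperOn (insert z L)ᶜ c)
    (hz : ∀ x, x ≠ z → x ∉ L → G.Adj x z → G.degreeOn (insert z L)ᶜ x < k) : G.rd ≤ k := by
  classical
  have hA : ∀ x, x ∈ (insert z L)ᶜ ↔ x ≠ z ∧ x ∉ L := by simp
  -- `f x` is the spare colour at `x`, to be given to the edge `xz`.
  have hf : ∀ x, ∃ i : Fin k, x ≠ z → x ∉ L → G.Adj x z →
      ∀ y, y ≠ z → y ∉ L → G.Adj x y → c x y ≠ i := by
    intro x
    by_cases h : x ≠ z ∧ x ∉ L ∧ G.Adj x z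
    · obtain ⟨i, hi⟩ := exists_color_ne_of_degreeOn_lt c (hz x h.1 h.2.1 h.2.2)
      exact ⟨i, fun _ _ _ y h1 h2 => hi y ((hA y).2 ⟨h1, h2⟩)⟩
    · exact ⟨c x x, fun h1 h2 h3 => absurd ⟨h1, h2, h3⟩ h⟩
  choose f hf using hf
  let d : V → V → Fin k := fun x y => if x = z then f y else if y = z then f x else c x y
  have hd : ∀ x y, d x y = d y x := by
    intro x y
    by_cases hx : x = z <;> by_cases hy : y = z <;> simp [d, hx, hy, hc.symm x y]
  have hinj : ∀ x, x ≠ z → x ∉ L → ∀ b b', b ∉ L → b' ∉ L → G.Adj x b → G.Adj x b' →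
      d x b = d x b' → b = b' := by
    intro x hxz hxL b b' hb hb' hxb hxb' he
    simp only [d, hxz, if_false] at he
    by_cases hbz : b = z <;> by_cases hbz' : b' = z
    · rw [hbz, hbz']
    · subst hbz
      simp only [hbz', if_true, if_false] at he
      exact absurd he.symm (hf x hxz hxL hxb b' hbz' hb' hxb')
    · subst hbz'
      simp only [hbz, if_true, if_false] at he
      exact absurd he (hf x hxz hxL hxb' b hbz hb hxb)
    · simp only [hbz, hbz', if_false] at he
      exact hc.inj x ((hA x).2 ⟨hxz, hxL⟩) b ((hA b).2 ⟨hbz, hb⟩) b' ((hA b').2 ⟨hbz', hb'⟩)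
        hxb hxb' he
  -- `S` is `x` together with its neighbours in `L`, so its boundary avoids the pendant edges, whose
  -- colours are uncontrolled.
  have hstar : ∀ x, x ≠ z → x ∉ L → ∃ S : Set V, x ∈ S ∧ (∀ y, y ∉ L → y ≠ x → y ∉ S) ∧
      ∀ a ∈ S, ∀ b ∉ S, ∀ a' ∈ S, ∀ b' ∉ S,
        G.Adj a b → G.Adj a' b' → d a b = d a' b' → a = a' ∧ b = b' := by
    intro x hxz hxL
    have hcross : ∀ a ∈ insert x {l | l ∈ L ∧ G.Adj x l}, ∀ b ∉ insert x {l | l ∈ L ∧ G.Adj x l},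
        G.Adj a b → a = x ∧ b ∉ L := by
      rintro a (rfl | ⟨ha, hxa⟩) b hb hab
      · exact ⟨rfl, fun hbL => hb (Or.inr ⟨hbL, hab⟩)⟩
      · exact absurd (Or.inl (hL a ha b x hab hxa.symm)) hb
    refine ⟨insert x {l | l ∈ L ∧ G.Adj x l}, Or.inl rfl, ?_, ?_⟩
    · rintro y hy hyx (rfl | h)
      · exact hyx rfl
      · exact hy h.1
    · intro a ha b hb a' ha' b' hb' hab hab' he
      obtain ⟨rfl, h1⟩ := hcross a ha b hb hab
      obtain ⟨rfl, h2⟩ := hcross a' ha' b' hb' hab'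
      exact ⟨rfl, hinj _ hxz hxL b b' h1 h2 hab hab' he⟩
  refine rd_le_of_cuts d hd fun u v huv => ?_
  by_cases huL : u ∈ L
  · refine ⟨{u}, rfl, huv.symm, ?_⟩
    rintro a rfl b hb a' rfl b' hb' hab hab' -
    exact ⟨rfl, hL _ huL _ _ hab hab'⟩
  by_cases hvL : v ∈ L
  · refine ⟨{v}ᶜ, huv, by simp, ?_⟩
    intro a _ b hb a' _ b' hb' hab hab' _
    obtain rfl : b = v := by simpa using hb
    obtain rfl : b' = b := by simpa using hb'
    exact ⟨hL _ hvL _ _ hab.symm hab'.symm, rfl⟩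
  by_cases huz : u = z
  · obtain ⟨S, h1, h2, h3⟩ := hstar v (by rintro rfl; exact huv huz) hvL
    refine ⟨Sᶜ, h2 u huL huv, by simpa using h1, ?_⟩
    intro a ha b hb a' ha' b' hb' hab hab' he
    rw [hd a b, hd a' b'] at he
    exact (h3 b (by simpa using hb) a ha b' (by simpa using hb') a' ha' hab.symm hab'.symm
      he).symm
  · obtain ⟨S, h1, h2, h3⟩ := hstar u huz huL
    exact ⟨S, h1, h2 v hvL huv.symm, h3⟩

end SimpleGraph

/-! ### Upper bounds. -/

namespace SimpleGraph

open Finset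

variable {V : Type*} {G : SimpleGraph V}

/-- Each of the two graphs has at least `n - 1` edges, and together they have `n(n - 1)/2`. -/
theorem four_le_card_of_connected_compl [Fintype V] [Nontrivial V] (h : G.Connected)
    (h' : Gᶜ.Connected) : 4 ≤ Fintype.card V := by
  classical
  have h1 := h.card_vert_le_card_edgeSet_add_one
  have h2 := h'.card_vert_le_card_edgeSet_add_one
  rw [Nat.card_eq_fintype_card, Nat.card_eq_fintype_card, ← edgeFinset_card] at h1 h2
  have h3 := G.sum_degrees_eq_twice_card_edges
  have h4 := Gᶜ.sum_degrees_eq_twice_card_edges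
  have hn : 1 < Fintype.card V := Fintype.one_lt_card
  have h5 : ∑ v, G.degree v + ∑ v, Gᶜ.degree v = Fintype.card V * (Fintype.card V - 1) := by
    rw [← sum_add_distrib, sum_congr rfl (g := fun _ => Fintype.card V - 1)]
    · simp
    · intro x _
      have := G.degree_lt_card_verts x
      rw [degree_compl]
      omega
  obtain ⟨m, hm⟩ : ∃ m, Fintype.card V = m + 2 := ⟨Fintype.card V - 2, by omega⟩
  rw [hm] at h1 h2 h5 ⊢
  rw [show m + 2 - 1 = m + 1 from rfl] at h5
  by_contra! hlt
  have : m ≤ 1 := by omega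
  nlinarith

theorem degreeOn_add_degreeOn_compl [DecidableEq V] {A : Finset V} {x : V} (hx : x ∈ A) :
    G.degreeOn A x + Gᶜ.degreeOn A x + 1 = #A := by
  classical
  unfold degreeOn
  rw [← card_erase_add_one hx, ← card_union_of_disjoint]
  · congr 2
    ext y
    simp only [mem_union, mem_filter, mem_erase, compl_adj]
    constructor
    · rintro (⟨h1, h2⟩ | ⟨h1, h2⟩)
      · exact ⟨h2.ne', h1⟩
      · exact ⟨h2.1.symm, h1⟩
    · rintro ⟨h1, h2⟩
      by_cases h : G.Adj x y
      · exact Or.inl ⟨h2, h⟩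
      · exact Or.inr ⟨h2, h1.symm, h⟩
  · refine Finset.disjoint_left.2 fun y h1 h2 => ?_
    simp only [mem_filter] at h1 h2
    exact h2.2.2 h1.2

theorem degreeOn_pos {A : Finset V} {x y : V} (hy : y ∈ A) (h : G.Adj x y) :
    1 ≤ G.degreeOn A x := by
  classical
  exact card_pos.2 ⟨y, by simp [hy, h]⟩

theorem two_le_degreeOn {A : Finset V} {x y y' : V} (hy : y ∈ A) (hy' : y' ∈ A) (hne : y ≠ y')
    (h : G.Adj x y) (h' : G.Adj x y') : 2 ≤ G.degreeOn A x := by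
  classical
  exact one_lt_card.2 ⟨y, by simp [hy, h], y', by simp [hy', h'], hne⟩

/-- In a connected graph with at least three vertices, some vertex can be removed without creating
an isolated vertex. -/
theorem Connected.exists_forall_exists_adj_ne [Fintype V] (h : G.Connected)
    (hn : 3 ≤ Fintype.card V) : ∃ z, ∀ x, x ≠ z → ∃ y, y ≠ z ∧ G.Adj x y := by
  classical
  by_contra! hne
  have : Nontrivial V := Fintype.one_lt_card_iff_nontrivial.1 (by omega)
  obtain ⟨z₀⟩ := h.nonempty
  -- The only possible neighbour of `x` is `z₀`, and that of `x'` is `x`. This forces `x' = z₀`, so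
  -- `{x, z₀}` is a whole component.
  obtain ⟨x, hx, hx'⟩ := hne z₀
  obtain ⟨x', hxx, hx''⟩ := hne x
  obtain ⟨y, hy⟩ := h.preconnected.exists_adj_of_nontrivial x'
  have hyx : y = x := by
    by_contra hh
    exact hx'' y hh hy
  subst hyx
  have hz : x' = z₀ := by
    by_contra hh
    exact hx' x' hh hy.symm
  subst hz
  obtain ⟨w, hw⟩ : ∃ w, w ∉ ({y, x'} : Finset V) := by
    by_contra! hall
    have := card_le_card (fun w _ => hall w : univ ⊆ ({y, x'} : Finset V))
    have := card_le_two (a := y) (b := x')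
    rw [card_univ] at *
    omega
  simp only [mem_insert, mem_singleton, not_or] at hw
  obtain ⟨a, ha, b, hb, hab⟩ := exists_adj_of_reachable (h.preconnected y w) (S := {y, x'})
    (Or.inl rfl) (by simpa using hw)
  simp only [Set.mem_insert_iff, Set.mem_singleton_iff, not_or] at ha hb
  rcases ha with rfl | rfl
  · exact hx' b hb.2 hab
  · exact hx'' b hb.1 hab

/-- If `Gᶜ - z` has no isolated vertex, then all degrees in `G - z` are at most `n - 3`: Vizing's
theorem applies with `n - 2` colours and leaves a spare one at each vertex. -/
theorem rd_le_card_sub_two [Fintype V] (h : Gᶜ.Connected) (hn : 3 ≤ Fintype.card V) :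
    G.rd ≤ Fintype.card V - 2 := by
  classical
  obtain ⟨z, hz⟩ := h.exists_forall_exists_adj_ne hn
  have : NeZero (Fintype.card V - 2) := ⟨by omega⟩
  have hA : ∀ x, x ≠ z → G.degreeOn (insert z ∅)ᶜ x < Fintype.card V - 2 := by
    intro x hx
    obtain ⟨y, hy, hxy⟩ := hz x hx
    have h1 := degreeOn_add_degreeOn_compl (G := G) (A := (insert z ∅)ᶜ) (x := x) (by simp [hx])
    have h2 := degreeOn_pos (A := (insert z ∅)ᶜ) (by simp [hy]) hxy
    rw [card_compl] at h1
    simp only [insert_empty_eq, card_singleton] at h1 h2 ⊢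
    omega
  obtain ⟨c, hc⟩ := exists_isProperOn_of_degreeOn_lt (insert z ∅)ᶜ fun x hx =>
    hA x (by simpa using hx)
  exact hc.rd_le z ∅ (by simp) fun x hx _ _ => hA x hx

/-- Without `u`, `v` and any third vertex `z`, only `n - 3` vertices are left, of degree at most `n
- 4`. -/
theorem rd_le_card_sub_three_of_two_leaves [Fintype V] (hn : 4 ≤ Fintype.card V) {u v : V}
    (huv : u ≠ v) (hu : ∀ a b, G.Adj u a → G.Adj u b → a = b)
    (hv : ∀ a b, G.Adj v a → G.Adj v b → a = b) : G.rd ≤ Fintype.card V - 3 := by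
  classical
  obtain ⟨z, hz⟩ : ∃ z, z ∉ ({u, v} : Finset V) := by
    by_contra! hall
    have := card_le_card (fun w _ => hall w : univ ⊆ ({u, v} : Finset V))
    have := card_le_two (a := u) (b := v)
    rw [card_univ] at *
    omega
  have hcard : #((insert z {u, v} : Finset V)ᶜ) = Fintype.card V - 3 := by
    rw [card_compl, card_insert_of_notMem hz, card_pair huv]
  have : NeZero (Fintype.card V - 3) := ⟨by omega⟩
  have hA : ∀ x ∈ (insert z {u, v} : Finset V)ᶜ,
      G.degreeOn (insert z {u, v})ᶜ x < Fintype.card V - 3 := by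
    intro x hx
    have h1 := degreeOn_add_degreeOn_compl (G := G) hx
    omega
  obtain ⟨c, hc⟩ := exists_isProperOn_of_degreeOn_lt _ hA
  refine hc.rd_le z {u, v} ?_ fun x hx hx' _ => hA x (by simpa [hx] using hx')
  intro l hl
  simp only [mem_insert, mem_singleton] at hl
  rcases hl with rfl | rfl
  · exact hu
  · exact hv

theorem rd_le_card_sub_three_of_one_leaf [Fintype V] (hn : 4 ≤ Fintype.card V)
    (hleaf : ∀ u v, (∀ a b, Gᶜ.Adj u a → Gᶜ.Adj u b → a = b) →
      (∀ a b, Gᶜ.Adj v a → Gᶜ.Adj v b → a = b) → u = v) :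
    G.rd ≤ Fintype.card V - 3 := by
  classical
  obtain ⟨z, f₁, f₂, hz, hf⟩ : ∃ z f₁ f₂ : V,
      (∀ x, x ≠ z → ∃ a b, Gᶜ.Adj x a ∧ Gᶜ.Adj x b ∧ a ≠ b) ∧
      ∀ x, x ≠ z → x ≠ f₁ → x ≠ f₂ →
        ∃ a b, Gᶜ.Adj x a ∧ Gᶜ.Adj x b ∧ a ≠ b ∧ a ≠ z ∧ b ≠ z := by
    have notadj : ∀ z x, (∃ a b, Gᶜ.Adj x a ∧ Gᶜ.Adj x b ∧ a ≠ b) → ¬ Gᶜ.Adj z x →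
        ∃ a b, Gᶜ.Adj x a ∧ Gᶜ.Adj x b ∧ a ≠ b ∧ a ≠ z ∧ b ≠ z := by
      rintro z x ⟨a, b, ha, hb, hab⟩ hzx
      exact ⟨a, b, ha, hb, hab, fun e => hzx (e ▸ ha.symm), fun e => hzx (e ▸ hb.symm)⟩
    -- Take `z` of complement degree at most one if possible, else at most two, else arbitrary. Only
    -- the complement neighbours of `z` (`f₁`, `f₂`) may then drop below two complement neighbours
    -- in `Gᶜ - z`.
    by_cases h1 : ∃ z, ∀ a b, Gᶜ.Adj z a → Gᶜ.Adj z b → a = b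
    · obtain ⟨z, hz⟩ := h1
      have hx : ∀ x, x ≠ z → ∃ a b, Gᶜ.Adj x a ∧ Gᶜ.Adj x b ∧ a ≠ b := by
        intro x hx
        by_contra! hh
        exact hx (hleaf x z hh hz)
      obtain ⟨f, hf⟩ : ∃ f, ∀ a, Gᶜ.Adj z a → a = f := by
        by_cases h2 : ∃ f, Gᶜ.Adj z f
        · obtain ⟨f, hf⟩ := h2
          exact ⟨f, fun a ha => hz a f ha hf⟩
        · exact ⟨z, fun a ha => absurd ⟨a, ha⟩ h2⟩
      exact ⟨z, f, f, hx, fun x hxz hxf _ => notadj z x (hx x hxz) fun e => hxf (hf x e)⟩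
    · push Not at h1
      by_cases h2 : ∃ z f₁ f₂, ∀ a, Gᶜ.Adj z a → a = f₁ ∨ a = f₂
      · obtain ⟨z, f₁, f₂, h⟩ := h2
        exact ⟨z, f₁, f₂, fun x _ => h1 x, fun x _ hx1 hx2 => notadj z x (h1 x) fun e =>
          (h x e).elim hx1 hx2⟩
      · push Not at h2
        have : Nonempty V := Fintype.card_pos_iff.1 (by omega)
        obtain ⟨z⟩ := this
        refine ⟨z, z, z, fun x _ => h1 x, fun x _ _ _ => ?_⟩
        obtain ⟨a, ha, haz, -⟩ := h2 x z z
        obtain ⟨b, hb, hbz, hba⟩ := h2 x z a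
        exact ⟨a, b, ha, hb, hba.symm, haz, hbz⟩
  have : NeZero (Fintype.card V - 3) := ⟨by omega⟩
  have hmem : ∀ x, x ∈ (insert z (∅ : Finset V))ᶜ ↔ x ≠ z := by simp
  have hdeg : ∀ x, x ≠ z → G.degreeOn (insert z ∅)ᶜ x + Gᶜ.degreeOn (insert z ∅)ᶜ x + 2 =
      Fintype.card V := by
    intro x hx
    have := degreeOn_add_degreeOn_compl (G := G) ((hmem x).2 hx)
    rw [card_compl] at this
    simp only [insert_empty_eq, card_singleton] at this ⊢
    omega
  obtain ⟨c, hc⟩ := exists_isProperOn_of_degreeOn_le (G := G) (k := Fintype.card V - 3)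
    (insert z ∅)ᶜ f₁ f₂ (fun x hx => by
      rw [hmem] at hx
      obtain ⟨a, b, ha, hb, hab⟩ := hz x hx
      have h1 : 1 ≤ Gᶜ.degreeOn (insert z ∅)ᶜ x := by
        by_cases haz : a = z
        · exact degreeOn_pos ((hmem b).2 fun e => hab (haz.trans e.symm)) hb
        · exact degreeOn_pos ((hmem a).2 haz) ha
      have := hdeg x hx
      omega) (fun x hx h1 h2 => by
      rw [hmem] at hx
      obtain ⟨a, b, ha, hb, hab, haz, hbz⟩ := hf x hx h1 h2
      have := two_le_degreeOn ((hmem a).2 haz) ((hmem b).2 hbz) hab ha hb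
      have := hdeg x hx
      omega)
  refine hc.rd_le z ∅ (by simp) fun x hx _ hxz => ?_
  obtain ⟨a, b, ha, hb, hab⟩ := hz x hx
  -- A neighbour `x` of `z` in `G` loses no complement neighbour with `z`, so it has a spare colour.
  have hne : ∀ y, Gᶜ.Adj x y → y ≠ z := by
    rintro y hy rfl
    exact hy.2 hxz
  have := two_le_degreeOn ((hmem a).2 (hne a ha)) ((hmem b).2 (hne b hb)) hab ha hb
  have := hdeg x hx
  omega

theorem rd_add_rd_compl_le [Fintype V] (h : G.Connected) (h' : Gᶜ.Connected)
    (hn : 4 ≤ Fintype.card V) : G.rd + Gᶜ.rd + 5 ≤ 2 * Fintype.card V := by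
  have h1 := rd_le_card_sub_two (G := G) h' (by omega)
  have h2 := rd_le_card_sub_two (G := Gᶜ) (by rwa [compl_compl]) (by omega)
  by_cases hleaf : ∀ u v, (∀ a b, Gᶜ.Adj u a → Gᶜ.Adj u b → a = b) →
      (∀ a b, Gᶜ.Adj v a → Gᶜ.Adj v b → a = b) → u = v
  · have := rd_le_card_sub_three_of_one_leaf hn hleaf
    omega
  · push Not at hleaf
    obtain ⟨u, v, hu, hv, huv⟩ := hleaf
    have := rd_le_card_sub_three_of_two_leaves hn huv hu hv
    omega

end SimpleGraph

/-! ### Lower bound by crossing cuts. -/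

namespace SimpleGraph

open Finset

variable {V : Type*} {G : SimpleGraph V} {k k' : ℕ}

theorem card_interedges_comm [DecidableRel G.Adj] (S T : Finset V) :
    #(G.interedges S T) = #(G.interedges T S) := by
  have : Std.Symm G.Adj := ⟨fun _ _ h => h.symm⟩
  exact Rel.card_interedges_comm (r := G.Adj) S T

variable [Fintype V]

theorem cutSize_compl [DecidableEq V] (S : Finset V) : G.cutSize Sᶜ = G.cutSize S := by
  classical
  unfold cutSize
  rw [card_interedges_comm]
  congr 2 <;> ext <;> simp

theorem cutSize_eq_sum [DecidableEq V] [DecidableRel G.Adj] (S : Finset V) : G.cutSize S =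
    ∑ p : V × V, if G.Adj p.1 p.2 ∧ p.1 ∈ S ∧ p.2 ∉ S then 1 else 0 := by
  unfold cutSize
  rw [sum_boole, Nat.cast_id]
  congr 1
  ext p
  simp only [mem_interedges_iff, mem_compl, mem_filter, mem_univ, true_and]
  tauto

theorem cutSize_inter_add_cutSize_union_le [DecidableEq V] (S T : Finset V) :
    G.cutSize (S ∩ T) + G.cutSize (S ∪ T) ≤ G.cutSize S + G.cutSize T := by
  classical
  simp only [cutSize_eq_sum, ← sum_add_distrib]
  refine sum_le_sum fun p _ => ?_
  by_cases h : G.Adj p.1 p.2 <;> by_cases h1 : p.1 ∈ S <;> by_cases h2 : p.1 ∈ T <;>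
    by_cases h3 : p.2 ∈ S <;> by_cases h4 : p.2 ∈ T <;> simp [h, h1, h2, h3, h4]

/-- Neighbours outside `S` are paid for by cut edges. Thus a side of a small cut that contains a
vertex of larger degree has at least two vertices. -/
theorem degreeOn_univ_add_one_le {S : Finset V} {x : V} (hx : x ∈ S) :
    G.degreeOn univ x + 1 ≤ #S + G.cutSize S := by
  classical
  have h1 : G.degreeOn univ x = #{y ∈ S | G.Adj x y} + #{y ∈ Sᶜ | G.Adj x y} := by
    unfold degreeOn
    rw [← card_union_of_disjoint (disjoint_filter_filter disjoint_compl_right), ← filter_union,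
      union_compl]
  have h2 : #{y ∈ S | G.Adj x y} < #S :=
    card_lt_card ⟨filter_subset _ _, fun h => by simpa using h hx⟩
  have h3 : #{y ∈ Sᶜ | G.Adj x y} ≤ G.cutSize S := by
    refine card_le_card_of_injOn (fun y => (x, y)) (fun y hy => ?_)
      (fun a _ b _ h => by simpa using h)
    simp only [coe_filter, Set.mem_ofPred_eq] at hy
    simpa [mem_interedges_iff, hx] using hy
  omega

/-- The pairs separated by both `S` and `T` are edges of the cut `S` of `G` or of the cut `T`
of the complement. -/
theorem card_mul_add_card_mul_le_cutSize_add [DecidableEq V] (S T : Finset V) :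
    #(S ∩ T) * #(Sᶜ \ T) + #(S \ T) * #(Sᶜ ∩ T) ≤ G.cutSize S + Gᶜ.cutSize T := by
  classical
  have d : Disjoint S Sᶜ := disjoint_compl_right
  have e1 := G.card_interedges_add_card_interedges_compl
    (d.mono (inter_subset_left (s₂ := T)) (sdiff_subset (t := T)))
  have e2 := G.card_interedges_add_card_interedges_compl
    (d.mono (sdiff_subset (t := T)) (inter_subset_left (s₂ := T)))
  have c1 : #(G.interedges (S ∩ T) (Sᶜ \ T)) + #(G.interedges (S \ T) (Sᶜ ∩ T)) ≤
      G.cutSize S := by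
    rw [← card_union_of_disjoint]
    · unfold cutSize
      refine card_le_card (union_subset ?_ ?_) <;> intro p hp <;>
        simp only [mem_interedges_iff, mem_inter, mem_sdiff, mem_compl] at hp ⊢ <;> tauto
    · refine Finset.disjoint_left.2 fun p hp hp' => ?_
      simp only [mem_interedges_iff, mem_inter, mem_sdiff] at hp hp'
      exact hp'.1.2 hp.1.2
  have c2 : #(Gᶜ.interedges (S ∩ T) (Sᶜ \ T)) + #(Gᶜ.interedges (S \ T) (Sᶜ ∩ T)) ≤
      Gᶜ.cutSize T := by
    rw [card_interedges_comm (S \ T), ← card_union_of_disjoint]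
    · unfold cutSize
      refine card_le_card (union_subset ?_ ?_) <;> intro p hp <;>
        simp only [mem_interedges_iff, mem_inter, mem_sdiff, mem_compl] at hp ⊢ <;> tauto
    · refine Finset.disjoint_left.2 fun p hp hp' => ?_
      simp only [mem_interedges_iff, mem_inter, mem_compl] at hp hp'
      exact hp'.1.1 hp.1.1
  rw [← e1, ← e2]
  omega

/-- If all are positive, add `p + q' ≤ p * q' + 1` and `p' + q ≤ p' * q + 1`. If `q = 0`, then `p ≥
2` and `q' ≥ p + p'`, so `p * q' ≥ 2 * q'` suffices; `q' = 0` is symmetric. -/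
theorem add_add_add_le_mul_add_mul_add_two {p p' q q' : ℕ} (hp : 1 ≤ p) (hp' : 1 ≤ p')
    (h : 2 ≤ p + q)
    (h' : 2 ≤ p' + q') (hle : p + p' ≤ q + q') : p + p' + (q + q') ≤ p * q' + p' * q + 2 := by
  rcases Nat.eq_zero_or_pos q with rfl | hq
  · nlinarith
  rcases Nat.eq_zero_or_pos q' with rfl | hq'
  · nlinarith
  obtain ⟨p, rfl⟩ := Nat.exists_eq_add_of_le hp
  obtain ⟨p', rfl⟩ := Nat.exists_eq_add_of_le hp'
  obtain ⟨q, rfl⟩ := Nat.exists_eq_add_of_le (Nat.succ_le_of_lt hq)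
  obtain ⟨q', rfl⟩ := Nat.exists_eq_add_of_le (Nat.succ_le_of_lt hq')
  nlinarith [Nat.zero_le (p * q'), Nat.zero_le (p' * q)]

/-- Two vertices of degree more than `k` in a graph all of whose local edge connectivities are
at most `k`: there is a cut of size at most `k`, the smaller side of which has exactly one
vertex of degree more than `k`. -/
theorem exists_cut_of_two_le [DecidableEq V]
    (hcut : ∀ u v, u ≠ v → ∃ S : Finset V, u ∈ S ∧ v ∉ S ∧ G.cutSize S ≤ k) {u v : V}
    (huv : u ≠ v) (hu : k < G.degreeOn univ u) (hv : k < G.degreeOn univ v) :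
    ∃ (S : Finset V) (x : V), x ∈ S ∧ k < G.degreeOn univ x ∧ G.cutSize S ≤ k ∧ #S ≤ #Sᶜ ∧
      ∀ x' ∈ S, k < G.degreeOn univ x' → x' = x := by
  classical
  have hmincut : ∀ x y : V, x ≠ y → ∃ S : Finset V, x ∈ S ∧ y ∉ S ∧
      ∀ T : Finset V, x ∈ T → y ∉ T → G.cutSize S ≤ G.cutSize T := by
    intro x y hxy
    obtain ⟨S, hS, hmin⟩ := exists_min_image (univ.filter fun S : Finset V => x ∈ S ∧ y ∉ S)
      G.cutSize ⟨{x}, by simpa using hxy.symm⟩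
    simp only [mem_filter, mem_univ, true_and] at hS hmin
    exact ⟨S, hS.1, hS.2, fun T h1 h2 => hmin T ⟨h1, h2⟩⟩
  let Q : Finset V → Prop := fun S => ∃ x ∈ S, ∃ y ∉ S, k < G.degreeOn univ x ∧
    k < G.degreeOn univ y ∧ ∀ T : Finset V, x ∈ T → y ∉ T → G.cutSize S ≤ G.cutSize T
  obtain ⟨S₀, h1, h2, h3⟩ := hmincut u v huv
  obtain ⟨S, hS, hmin⟩ := exists_min_image (univ.filter Q) card
    ⟨S₀, by simpa [Q] using ⟨u, h1, v, h2, hu, hv, h3⟩⟩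
  simp only [mem_filter, mem_univ, true_and] at hS hmin
  obtain ⟨x, hx, y, hy, hdx, hdy, hxy⟩ := hS
  refine ⟨S, x, hx, hdx, ?_, ?_, ?_⟩
  · obtain ⟨T, hxT, hyT, hT⟩ := hcut x y (by rintro rfl; exact hy hx)
    exact (hxy T hxT hyT).trans hT
  -- `Sᶜ` is also a minimum cut between two large vertices, so the smallest such set `S` is no
  -- bigger.
  · refine hmin _ ⟨y, by simpa using hy, x, by simpa using hx, hdy, hdx, fun T h1 h2 => ?_⟩
    rw [cutSize_compl, ← cutSize_compl T]
    exact hxy _ (by simpa using h2) (by simpa using h1)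
  · intro x' hx' hdx'
    by_contra hne
    -- Uncrossing: let `W` be the side avoiding `y` of a minimum cut between `x` and `x'`. Since `S
    -- ∪ W` still separates `x` from `y`, submodularity makes `S ∩ W` a minimum `a`-`b` cut, smaller
    -- than `S`.
    obtain ⟨W, a, b, haS, hbS, hda, hdb, haW, hbW, hyW, hW⟩ : ∃ (W : Finset V) (a b : V),
        a ∈ S ∧ b ∈ S ∧ k < G.degreeOn univ a ∧ k < G.degreeOn univ b ∧ a ∈ W ∧ b ∉ W ∧ y ∉ W ∧
        ∀ T : Finset V, a ∈ T → b ∉ T → G.cutSize W ≤ G.cutSize T := by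
      obtain ⟨W, hW1, hW2, hW3⟩ := hmincut x' x hne
      by_cases hyW : y ∈ W
      · refine ⟨Wᶜ, x, x', hx, hx', hdx, hdx', by simpa using hW2, by simpa using hW1,
          by simpa using hyW, fun T h1 h2 => ?_⟩
        rw [cutSize_compl, ← cutSize_compl T]
        exact hW3 _ (by simpa using h2) (by simpa using h1)
      · exact ⟨W, x', x, hx', hx, hdx', hdx, hW1, hW2, hyW, hW3⟩
    have hsub := G.cutSize_inter_add_cutSize_union_le S W
    have hle := hxy (S ∪ W) (mem_union_left _ hx) (by simp [hy, hyW])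
    have hcard := hmin (S ∩ W) ⟨a, by simp [haS, haW], b, by simp [hbW], hda, hdb, fun T h1 h2 => by
      have := hW T h1 h2
      omega⟩
    have : #(S ∩ W) < #S :=
      card_lt_card ⟨inter_subset_left, fun h => hbW (mem_inter.1 (h hbS)).2⟩
    omega

theorem card_lt_add_three_of_two_le
    (hcut : ∀ u v, u ≠ v → ∃ S : Finset V, u ∈ S ∧ v ∉ S ∧ G.cutSize S ≤ k)
    (hcut' : ∀ u v, u ≠ v → ∃ S : Finset V, u ∈ S ∧ v ∉ S ∧ Gᶜ.cutSize S ≤ k') {u v : V}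
    (huv : u ≠ v) (hu : k < G.degreeOn univ u) (hv : k < G.degreeOn univ v) :
    Fintype.card V < k + k' + 3 := by
  classical
  by_contra! hn
  obtain ⟨S, x, hx, hdx, hSk, hSS, hSx⟩ := exists_cut_of_two_le hcut huv hu hv
  have hdeg : ∀ y, G.degreeOn univ y + Gᶜ.degreeOn univ y + 1 = Fintype.card V := fun y =>
    degreeOn_add_degreeOn_compl (mem_univ y)
  have hS2 : 2 ≤ #S := by
    have := G.degreeOn_univ_add_one_le hx
    omega
  -- Otherwise `T` separates `b₁` from `b₂`, with at least two vertices on each side. The pairs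
  -- separated by both `S` and `T` then number at least `n - 2 > k + k'`.
  have hB : ∀ b₁ ∈ S, ∀ b₂ ∈ S, k' < Gᶜ.degreeOn univ b₁ → k' < Gᶜ.degreeOn univ b₂ →
      b₁ = b₂ := by
    intro b₁ hb₁ b₂ hb₂ h1 h2
    by_contra hne
    obtain ⟨T, hT1, hT2, hTk⟩ := hcut' b₁ b₂ hne
    have hT := Gᶜ.degreeOn_univ_add_one_le hT1
    have hT' := Gᶜ.degreeOn_univ_add_one_le (mem_compl.2 hT2)
    rw [cutSize_compl] at hT'
    have hcross := G.card_mul_add_card_mul_le_cutSize_add S T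
    have e1 := card_inter_add_card_sdiff S T
    have e2 := card_inter_add_card_sdiff Sᶜ T
    have e3 := card_add_card_compl S
    have e4 := card_add_card_compl T
    have e5 : #T = #(S ∩ T) + #(Sᶜ ∩ T) := by
      rw [← card_inter_add_card_sdiff T S, inter_comm T S, inter_comm Sᶜ T, sdiff_eq_inter_compl]
    have := add_add_add_le_mul_add_mul_add_two (p := #(S ∩ T)) (p' := #(S \ T))
      (q := #(Sᶜ ∩ T)) (q' := #(Sᶜ \ T))
      (card_pos.2 ⟨b₁, by simp [hb₁, hT1]⟩) (card_pos.2 ⟨b₂, by simp [hb₂, hT2]⟩)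
      (by omega) (by omega) (by omega)
    omega
  have hother : ∀ t ∈ S, t ≠ x → k' < Gᶜ.degreeOn univ t := by
    intro t ht htx
    have h1 : ¬ k < G.degreeOn univ t := fun h => htx (hSx t ht h)
    have := hdeg t
    omega
  obtain ⟨t, ht, htx⟩ := exists_mem_ne (by omega : 1 < #S) x
  have hxB : ¬ k' < Gᶜ.degreeOn univ x := fun h => htx (hB t ht x hx (hother t ht htx) h)
  have hS2' : #S ≤ 2 := by
    refine (card_le_card (t := {x, t}) fun s hs => ?_).trans card_le_two
    by_cases hsx : s = x
    · simp [hsx]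
    · simp [hB s hs t ht (hother s hs hsx) (hother t ht htx)]
  have := G.degreeOn_univ_add_one_le hx
  have := hdeg x
  omega

theorem card_le_rd_add_rd_compl (G : SimpleGraph V) :
    Fintype.card V ≤ G.rd + Gᶜ.rd + 2 := by
  classical
  by_contra! hlt
  have hcut := fun u v (h : u ≠ v) => G.exists_cutSize_le_rd h
  have hcut' := fun u v (h : u ≠ v) => Gᶜ.exists_cutSize_le_rd h
  have hAB : ∀ y, G.rd < G.degreeOn univ y ∨ Gᶜ.rd < Gᶜ.degreeOn univ y := by
    intro y
    have : G.degreeOn univ y + Gᶜ.degreeOn univ y + 1 = Fintype.card V :=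
      degreeOn_add_degreeOn_compl (mem_univ y)
    omega
  have h1 : #{y : V | G.rd < G.degreeOn univ y} ≤ 1 := by
    refine card_le_one.2 fun u hu v hv => ?_
    simp only [mem_filter, mem_univ, true_and] at hu hv
    by_contra hne
    have := card_lt_add_three_of_two_le hcut hcut' hne hu hv
    omega
  have h2 : #{y : V | Gᶜ.rd < Gᶜ.degreeOn univ y} ≤ 1 := by
    refine card_le_one.2 fun u hu v hv => ?_
    simp only [mem_filter, mem_univ, true_and] at hu hv
    by_contra hne
    have := card_lt_add_three_of_two_le hcut' (by simpa only [compl_compl] using hcut) hne hu hv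
    omega
  have h3 : (univ : Finset V) ⊆ (univ.filter fun y => G.rd < G.degreeOn univ y) ∪
      univ.filter fun y => Gᶜ.rd < Gᶜ.degreeOn univ y := by
    intro y _
    simpa using hAB y
  have := (card_le_card h3).trans (card_union_le _ _)
  rw [card_univ] at this
  omega

end SimpleGraph

/-! ### Sharpness. -/

namespace SimpleGraph

open Finset

variable {V : Type*} {G : SimpleGraph V}

theorem Connected.rd_pos [Finite V] [Nontrivial V] (h : G.Connected) : 0 < G.rd := by
  obtain ⟨a⟩ := h.nonempty
  obtain ⟨b, hab⟩ := h.preconnected.exists_adj_of_nontrivial a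
  obtain ⟨c, -⟩ := G.exists_isRainbowDisconnectionColoring_rd
  exact (Nat.zero_le _).trans_lt (c ⟨s(a, b), hab⟩).isLt

/-- Two adjacent vertices with common neighbours `T` are joined by `#T + 1` edge-disjoint paths. -/
theorem card_add_one_le_rd [Fintype V] {u v : V} (huv : G.Adj u v) (T : Finset V)
    (hT : ∀ x ∈ T, G.Adj x u ∧ G.Adj x v) : #T + 1 ≤ G.rd := by
  classical
  obtain ⟨S, hu, hv, hS⟩ := G.exists_cutSize_le_rd huv.ne
  refine le_trans ?_ hS
  have huT : u ∉ T := fun h => (hT u h).1.ne rfl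
  have hvT : v ∉ T := fun h => (hT v h).2.ne rfl
  rw [← card_insert_of_notMem huT]
  unfold cutSize
  -- Each path `u, x, v` crosses the cut at `xv` or at `ux`; the index `x = u` stands for the edge
  -- `uv`.
  refine card_le_card_of_injOn (fun x => if x ∈ S then (x, v) else (u, x)) ?_ ?_
  · intro x hx
    simp only [coe_insert, Set.mem_insert_iff, mem_coe] at hx
    rcases hx with rfl | hx
    · simp [hu, hv, huv, mem_interedges_iff]
    · by_cases hxS : x ∈ S
      · simp [hxS, hv, (hT x hx).2, mem_interedges_iff]
      · simp [hxS, hu, (hT x hx).1.symm, mem_interedges_iff]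
  · intro x hx x' hx' he
    simp only [coe_insert, Set.mem_insert_iff, mem_coe] at hx hx'
    have hne : ∀ t, t = u ∨ t ∈ T → t ∉ S → t ≠ v := by
      rintro t (rfl | ht) htS rfl
      · exact htS hu
      · exact hvT ht
    by_cases hxS : x ∈ S <;> by_cases hxS' : x' ∈ S <;>
      simp only [hxS, hxS', if_true, if_false, Prod.mk.injEq] at he
    · exact he.1
    · exact absurd he.2.symm (hne x' hx' hxS')
    · exact absurd he.2 (hne x hx hxS)
    · exact he.2

theorem extremalGraph_adj {u v w y a b : V} : (extremalGraph u v w y).Adj a b ↔ a ≠ b ∧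
    (((a = u ∧ b = v) ∨ ((a ≠ u ∧ a ≠ v ∧ a ≠ w) ∧ (b = u ∨ b = v)) ∨ (a = w ∧ b = y)) ∨
      ((b = u ∧ a = v) ∨ ((b ≠ u ∧ b ≠ v ∧ b ≠ w) ∧ (a = u ∨ a = v)) ∨ (b = w ∧ a = y))) := by
  simp [extremalGraph, fromRel_adj]

theorem extremalGraph_connected {u v w y : V} (huv : u ≠ v) (huw : u ≠ w) (hyu : y ≠ u)
    (hyv : y ≠ v) (hyw : y ≠ w) : (extremalGraph u v w y).Connected := by
  have hy : (extremalGraph u v w y).Adj u y := by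
    rw [extremalGraph_adj]; simp [*, hyu.symm]
  refine (connected_iff_exists_forall_reachable _).2 ⟨u, fun x => ?_⟩
  by_cases hxu : x = u
  · rw [hxu]
  by_cases hxw : x = w
  · subst hxw
    refine hy.reachable.trans (Adj.reachable ?_)
    rw [extremalGraph_adj]; simp [*]
  · refine Adj.reachable ?_
    rw [extremalGraph_adj]
    by_cases hxv : x = v
    · subst hxv; simp [huv]
    · simp [*, Ne.symm hxu]

theorem extremalGraph_compl_adj_left {u v w y x : V} (hxw : x ≠ w) (hxy : x ≠ y)
    (huw : u ≠ w) (hvw : v ≠ w) (hyw : y ≠ w) : (extremalGraph u v w y)ᶜ.Adj w x := by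
  rw [compl_adj, extremalGraph_adj]
  refine ⟨hxw.symm, ?_⟩
  simp [*, huw.symm, hvw.symm, hyw.symm]

theorem extremalGraph_compl_adj {u v w y a b : V} (hab : a ≠ b) (hau : a ≠ u) (hav : a ≠ v)
    (haw : a ≠ w) (hbu : b ≠ u) (hbv : b ≠ v) (hbw : b ≠ w) :
    (extremalGraph u v w y)ᶜ.Adj a b := by
  rw [compl_adj, extremalGraph_adj]
  simp [*]

theorem extremalGraph_compl_connected {u v w y x : V} (hxu : x ≠ u) (hxv : x ≠ v)
    (hxw : x ≠ w) (hxy : x ≠ y) (huw : u ≠ w) (hvw : v ≠ w) (hyu : y ≠ u) (hyv : y ≠ v)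
    (hyw : y ≠ w) : (extremalGraph u v w y)ᶜ.Connected := by
  refine (connected_iff_exists_forall_reachable _).2 ⟨w, fun t => ?_⟩
  by_cases htw : t = w
  · rw [htw]
  by_cases hty : t = y
  · subst hty
    exact (extremalGraph_compl_adj_left hxw hxy huw hvw hyw).reachable.trans
      (extremalGraph_compl_adj hxy hxu hxv hxw hyu hyv hyw).reachable
  · exact (extremalGraph_compl_adj_left htw hty huw hvw hyw).reachable

theorem card_le_rd_extremalGraph_add_two [Fintype V] {u v w y : V} (huv : u ≠ v) :
    Fintype.card V ≤ (extremalGraph u v w y).rd + 2 := by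
  classical
  have h := card_add_one_le_rd (G := extremalGraph u v w y) (u := u) (v := v)
    (by rw [extremalGraph_adj]; simp [huv]) ({u, v, w} : Finset V)ᶜ (by
      intro x hx
      simp only [mem_compl, mem_insert, mem_singleton, not_or] at hx
      rw [extremalGraph_adj, extremalGraph_adj]
      simp [hx])
  have h1 := card_add_card_compl ({u, v, w} : Finset V)
  have h2 := card_le_three (a := u) (b := v) (c := w)
  omega

/-- The bound `6 ≤ n` provides two vertices outside `{u, v, w, y}`; they are adjacent in the
complement, with every vertex but themselves, `u` and `v` as a common neighbour. -/
theorem card_le_rd_extremalGraph_compl_add_three [Fintype V] {u v w y : V}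
    (hn : 6 ≤ Fintype.card V) (huw : u ≠ w) (hvw : v ≠ w) (hyw : y ≠ w) :
    Fintype.card V ≤ (extremalGraph u v w y)ᶜ.rd + 3 := by
  classical
  have h1 := card_add_card_compl ({u, v, w, y} : Finset V)
  have h2 := card_le_four (a := u) (b := v) (c := w) (d := y)
  obtain ⟨x, hx, x', hx', hne⟩ := one_lt_card.1 (show 1 < #({u, v, w, y} : Finset V)ᶜ by omega)
  simp only [mem_compl, mem_insert, mem_singleton, not_or] at hx hx'
  obtain ⟨hxu, hxv, hxw, hxy⟩ := hx
  obtain ⟨hxu', hxv', hxw', hxy'⟩ := hx'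
  have h := card_add_one_le_rd (G := (extremalGraph u v w y)ᶜ) (u := x) (v := x')
    (extremalGraph_compl_adj hne hxu hxv hxw hxu' hxv' hxw') ({u, v, x, x'} : Finset V)ᶜ (by
      intro t ht
      simp only [mem_compl, mem_insert, mem_singleton, not_or] at ht
      obtain ⟨htu, htv, htx, htx'⟩ := ht
      by_cases htw : t = w
      · subst htw
        exact ⟨extremalGraph_compl_adj_left hxw hxy huw hvw hyw,
          extremalGraph_compl_adj_left hxw' hxy' huw hvw hyw⟩
      · exact ⟨extremalGraph_compl_adj htx htu htv htw hxu hxv hxw,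
          extremalGraph_compl_adj htx' htu htv htw hxu' hxv' hxw'⟩)
  have h3 := card_add_card_compl ({u, v, x, x'} : Finset V)
  have h4 := card_le_four (a := u) (b := v) (c := x) (d := x')
  omega

/-- A decidable criterion, so that `P₄` and its complement can be settled by `decide`. -/
theorem rd_le_one_of_cuts [Fintype V] [DecidableEq V] [DecidableRel G.Adj]
    (h : ∀ u v : V, u ≠ v → ∃ S : Finset V, u ∈ S ∧ v ∉ S ∧ #(G.interedges S Sᶜ) ≤ 1) :
    G.rd ≤ 1 := by
  refine rd_le_of_cuts (fun _ _ => 0) (fun _ _ => rfl) fun u v huv => ?_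
  obtain ⟨S, hu, hv, hS⟩ := h u v huv
  refine ⟨S, hu, hv, fun a ha b hb a' ha' b' hb' h1 h2 _ => ?_⟩
  have := card_le_one.1 hS (a, b) (by simpa [mem_interedges_iff, h1] using ⟨ha, hb⟩) (a', b')
    (by simpa [mem_interedges_iff, h2] using ⟨ha', hb'⟩)
  simpa using this

instance : DecidableRel (pathGraph 4).Adj := fun _ _ => decidable_of_iff' _ pathGraph_adj

theorem pathGraph_four_rd_le : (pathGraph 4).rd ≤ 1 :=
  rd_le_one_of_cuts (by decide)

/-- The path `2, 0, 3, 1` is the complement of the path `0, 1, 2, 3`. -/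
def pathGraphFourComplIso : (pathGraph 4)ᶜ ≃g pathGraph 4 where
  toFun := ![1, 3, 0, 2]
  invFun := ![2, 0, 3, 1]
  left_inv := by decide
  right_inv := by decide
  map_rel_iff' := by decide

theorem pathGraph_four_compl_rd_le : (pathGraph 4)ᶜ.rd ≤ 1 :=
  rd_le_one_of_cuts (by decide)

end SimpleGraph

theorem theorem4 :
    -- the bounds
    (∀ (V : Type*) [Fintype V] [Nontrivial V] (G : SimpleGraph V) (n : ℕ),
      Fintype.card V = n → G.Connected → Gᶜ.Connected →
        ((n : ℤ) - 2 ≤ (G.rd : ℤ) + (Gᶜ.rd : ℤ) ∧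
          (G.rd : ℤ) + (Gᶜ.rd : ℤ) ≤ 2 * (n : ℤ) - 5) ∧
        ((n : ℤ) - 3 ≤ (G.rd : ℤ) * (Gᶜ.rd : ℤ) ∧
          (G.rd : ℤ) * (Gᶜ.rd : ℤ) ≤ ((n : ℤ) - 2) * ((n : ℤ) - 3))) ∧
    -- sharpness of the upper bounds, for every order `n ≥ 6`
    (∀ n : ℕ, 6 ≤ n → ∀ u v w y : Fin n,
      u ≠ v → u ≠ w → v ≠ w → y ≠ u → y ≠ v → y ≠ w →
        (SimpleGraph.extremalGraph u v w y).Connected ∧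
        (SimpleGraph.extremalGraph u v w y)ᶜ.Connected ∧
        ((SimpleGraph.extremalGraph u v w y).rd : ℤ) +
          ((SimpleGraph.extremalGraph u v w y)ᶜ.rd : ℤ) = 2 * (n : ℤ) - 5 ∧
        ((SimpleGraph.extremalGraph u v w y).rd : ℤ) *
          ((SimpleGraph.extremalGraph u v w y)ᶜ.rd : ℤ) = ((n : ℤ) - 2) * ((n : ℤ) - 3)) ∧
    -- sharpness of the lower bounds, for the path of order `4`, which is its own complement
    ((SimpleGraph.pathGraph 4).Connected ∧
      Nonempty ((SimpleGraph.pathGraph 4)ᶜ ≃g SimpleGraph.pathGraph 4) ∧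
      ((SimpleGraph.pathGraph 4).rd : ℤ) + ((SimpleGraph.pathGraph 4)ᶜ.rd : ℤ) = (4 : ℤ) - 2 ∧
      ((SimpleGraph.pathGraph 4).rd : ℤ) * ((SimpleGraph.pathGraph 4)ᶜ.rd : ℤ) = (4 : ℤ) - 3) := by
  refine ⟨?_, ?_, ?_⟩
  · intro V _ _ G n hn h h'
    have h4 := SimpleGraph.four_le_card_of_connected_compl h h'
    have h1 := SimpleGraph.rd_add_rd_compl_le h h' h4
    have h2 := G.card_le_rd_add_rd_compl
    have h5 := h.rd_pos
    have h6 := h'.rd_pos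
    rw [hn] at h1 h2 h4
    generalize G.rd = a at *
    generalize Gᶜ.rd = b at *
    clear hn
    zify at h1 h2 h4 h5 h6
    refine ⟨⟨by linarith, by linarith⟩, by nlinarith, ?_⟩
    have hab : (a : ℤ) * b ≤ a * (2 * n - 5 - a) := by
      refine mul_le_mul_of_nonneg_left ?_ h5.le
      linarith
    -- The roots are consecutive integers, so no integer `a` lies strictly between them.
    have hsq : (0 : ℤ) ≤ (a - (n - 2)) * (a - (n - 3)) := by
      rcases le_or_gt (a : ℤ) (n - 3) with ha | ha
      · exact mul_nonneg_of_nonpos_of_nonpos (by linarith) (by linarith)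
      · exact mul_nonneg (by omega) (by linarith)
    nlinarith
  · intro n hn u v w y huv huw hvw hyu hyv hyw
    have hcard : Fintype.card (Fin n) = n := Fintype.card_fin n
    have h := SimpleGraph.extremalGraph_connected huv huw hyu hyv hyw
    obtain ⟨x, hx⟩ : ∃ x, x ∉ ({u, v, w, y} : Finset (Fin n)) := by
      by_contra! hall
      have h1 := Finset.card_le_card
        (fun x _ => hall x : Finset.univ ⊆ ({u, v, w, y} : Finset (Fin n)))
      have h2 := Finset.card_le_four (a := u) (b := v) (c := w) (d := y)
      rw [Finset.card_univ, hcard] at h1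
      omega
    simp only [Finset.mem_insert, Finset.mem_singleton, not_or] at hx
    have h' := SimpleGraph.extremalGraph_compl_connected hx.1 hx.2.1 hx.2.2.1 hx.2.2.2 huw hvw
      hyu hyv hyw
    have h1 := SimpleGraph.rd_add_rd_compl_le h h' (by omega)
    have h2 := SimpleGraph.card_le_rd_extremalGraph_add_two (w := w) (y := y) huv
    have h3 := SimpleGraph.card_le_rd_extremalGraph_compl_add_three (by omega) huw hvw hyw
    rw [hcard] at h1 h2 h3
    have e1 : ((SimpleGraph.extremalGraph u v w y).rd : ℤ) = n - 2 := by omega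
    have e2 : ((SimpleGraph.extremalGraph u v w y)ᶜ.rd : ℤ) = n - 3 := by omega
    exact ⟨h, h', by rw [e1, e2]; ring, by rw [e1, e2]⟩
  · have h : (SimpleGraph.pathGraph 4).Connected := SimpleGraph.pathGraph_connected 3
    have h' : (SimpleGraph.pathGraph 4)ᶜ.Connected :=
      SimpleGraph.pathGraphFourComplIso.connected_iff.2 h
    have e1 : (SimpleGraph.pathGraph 4).rd = 1 :=
      le_antisymm SimpleGraph.pathGraph_four_rd_le h.rd_pos
    have e2 : (SimpleGraph.pathGraph 4)ᶜ.rd = 1 :=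
      le_antisymm SimpleGraph.pathGraph_four_compl_rd_le h'.rd_pos
    exact ⟨h, ⟨SimpleGraph.pathGraphFourComplIso⟩, by rw [e1, e2]; norm_num,
      by rw [e1, e2]; norm_num⟩
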